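/- **Theorem 2.1.** Let $n\ge 1$, and let $(R_1,\dots,R_{2n})$ be a uniformly random ordering of the multiset $\{1,1,2,2,\dots,n,n\}$, i.e. each of its $(2n)!/2^n$ orderings has probability $2^n/(2n)!$; $R_j$ is the absolute rank of the $j$-th applicant ($1$ is best). For $1\le j\le 2n$ let $X_j$ be the number of different values in $\{R_i: R_i\le R_j,\ 1\le i\le j\}$ (the relative rank of the $j$-th applicant), let $D_j$ be the number of distinct values in $\{R_1,\dots,R_j\}$, let $S_j$ be the number of indices $i\le j$ with $R_i=\min\{R_1,\dots,R_j\}$, and let $\mathcal F_j$ be the $\sigma$-algebra generated by $(X_1,D_1),\dots,(X_j,D_j)$. Let $\mathcal M_n$ be the set of all stopping times $\tau$ with respect to $(\mathcal F_j)$ with values in $\{1,\dots,2n\}$. Let $$\alpha(i)=\frac{2n}{i}+\sum_{j=i+1}^{n}\frac1{j-1}\quad(i\ge 1),\qquad r_n=\min\{i\ge 1:\ \alpha(i)\le 5\}.$$ Then the rule $$\tau_n=\min\{\,1\le i\le 2n:\ X_i=1,\ S_i=2\ \text{and}\ D_i\ge r_n\,\}\qquad(\min\varnothing:=2n)$$ belongs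 to $\mathcal M_n$ and maximizes the probability of selecting a best applicant: $$P(R_{\tau_n}=1)=\sup_{\tau\in\mathcal M_n}P(R_\tau=1).$$ -/

import Mathlib

open MeasureTheory

namespace DoubleSecretary

/-- `X_j`: relative rank of the `j`-th applicant among the first `j`, i.e. the number of different
values in `{r i : r i ≤ r j, 1 ≤ i ≤ j}`. Applicants are numbered `1, 2, …`. -/
def relRank (r : ℕ → ℕ) (j : ℕ) : ℕ :=
  (((Finset.Icc 1 j).filter fun i => r i ≤ r j).image r).card

/-- `D_j`: number of distinct values in `{r 1, …, r j}`. -/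
def numDistinct (r : ℕ → ℕ) (j : ℕ) : ℕ :=
  ((Finset.Icc 1 j).image r).card

/-- `S_j`: number of times that the best (smallest) of the ranks `r 1, …, r j` occurs among
`r 1, …, r j`. -/
def bestCount (r : ℕ → ℕ) (j : ℕ) : ℕ :=
  ((Finset.Icc 1 j).filter fun i : ℕ => ∀ k ≤ j, 1 ≤ k → r i ≤ r k).card

/-- `(σ 1, …, σ (2n))` is an ordering of the multiset `1, 1, 2, 2, …, n, n`. -/
def IsOrdering (n : ℕ) (σ : ℕ → ℕ) : Prop :=
  (∀ j ∈ Finset.Icc 1 (2 * n), σ j ∈ Finset.Icc 1 n) ∧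
    ∀ k ∈ Finset.Icc 1 n, ((Finset.Icc 1 (2 * n)).filter fun j => σ j = k).card = 2

/-- `α(i) = 2n/i + ∑_{j=i+1}^n 1/(j-1)`, used for `i ≥ 1` only. -/
noncomputable def alpha (n i : ℕ) : ℝ :=
  2 * (n : ℝ) / (i : ℝ) + ∑ j ∈ Finset.Icc (i + 1) n, 1 / ((j : ℝ) - 1)

/-- `r_n = min {i ≥ 1 : α(i) ≤ 5}`. -/
noncomputable def threshold (n : ℕ) : ℕ :=
  sInf {i : ℕ | 1 ≤ i ∧ alpha n i ≤ 5}

variable {Ω : Type*}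

/-- What is observed at the `j`-th interview: `(X_j, D_j)`. -/
def obs (R : ℕ → Ω → ℕ) (j : ℕ) (ω : Ω) : ℕ × ℕ :=
  (relRank (fun i => R i ω) j, numDistinct (fun i => R i ω) j)

theorem measurable_obs [MeasurableSpace Ω] {R : ℕ → Ω → ℕ} (hR : ∀ j, Measurable (R j)) (j : ℕ) :
    Measurable (obs R j) := by
  let e : (Fin (j + 1) → ℕ) → ℕ → ℕ := fun v i => if h : i < j + 1 then v ⟨i, h⟩ else 0
  let g : (Fin (j + 1) → ℕ) → ℕ × ℕ := fun v => (relRank (e v) j, numDistinct (e v) j)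
  have hg : Measurable g := Measurable.of_discrete
  have hf : Measurable fun ω => fun i : Fin (j + 1) => R i ω :=
    measurable_pi_lambda _ fun i => hR i
  have h : obs R j = g ∘ fun ω => fun i : Fin (j + 1) => R i ω := by
    funext ω
    have he : ∀ i, i ≤ j → e (fun i : Fin (j + 1) => R i ω) i = R i ω := by
      intro i hi
      exact dif_pos (Nat.lt_succ_of_le hi)
    simp only [obs, g, Function.comp, Prod.mk.injEq]
    constructor
    · unfold relRank
      congr 1
      ext y
      simp only [Finset.mem_image, Finset.mem_filter, Finset.mem_Icc]
      constructor
      · rintro ⟨i, ⟨⟨h1, h2⟩, h3⟩, h4⟩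
        exact ⟨i, ⟨⟨h1, h2⟩, by rw [he i h2, he j le_rfl]; exact h3⟩, by rw [he i h2]; exact h4⟩
      · rintro ⟨i, ⟨⟨h1, h2⟩, h3⟩, h4⟩
        rw [he i h2, he j le_rfl] at h3
        rw [he i h2] at h4
        exact ⟨i, ⟨⟨h1, h2⟩, h3⟩, h4⟩
    · unfold numDistinct
      congr 1
      apply Finset.image_congr
      intro i hi
      exact (he i (Finset.mem_Icc.mp hi).2).symm
  rw [h]
  exact hg.comp hf

/-- The filtration `F_j = σ((X_1, D_1), …, (X_j, D_j))` (at index `0` the observation is the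
constant `(0, 0)`, so `F_0` is trivial). -/
def obsFiltration [m : MeasurableSpace Ω] (R : ℕ → Ω → ℕ) (hR : ∀ j, Measurable (R j)) :
    Filtration ℕ m :=
  Filtration.natural (obs R) fun j => (measurable_obs hR j).stronglyMeasurable

/-- The admissible stopping rules: stopping times of the observation filtration with values in
`{1, …, 2n}`. -/
def stoppingRules [MeasurableSpace Ω] (n : ℕ) (R : ℕ → Ω → ℕ) (hR : ∀ j, Measurable (R j)) :
    Set (Ω → ℕ) :=
  {τ | (∀ ω, τ ω ∈ Finset.Icc 1 (2 * n)) ∧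
    IsStoppingTime (obsFiltration R hR) fun ω => (τ ω : WithTop ℕ)}

/-- The winning probability `P(R_τ = 1)` of a rule `τ`. -/
noncomputable def winProb [MeasurableSpace Ω] (P : Measure Ω) (R : ℕ → Ω → ℕ) (τ : Ω → ℕ) : ℝ :=
  P.real {ω | R (τ ω) ω = 1}

/-- `τ_n = min {i ≥ 1 : X_i = 1, S_i = 2, D_i ≥ r_n}`, the minimum being over `1 ≤ i ≤ 2n`; the
rule takes the last applicant, `τ_n = 2n`, if there is no such `i`. -/
noncomputable def thresholdRule (n : ℕ) (R : ℕ → Ω → ℕ) : Ω → ℕ :=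
  hittingBtwn
    (fun i ω => (relRank (fun k => R k ω) i, bestCount (fun k => R k ω) i,
      numDistinct (fun k => R k ω) i))
    {p : ℕ × ℕ × ℕ | p.1 = 1 ∧ p.2.1 = 2 ∧ threshold n ≤ p.2.2} 1 (2 * n)

end DoubleSecretary

namespace DoubleSecretary

/-! The proof is dynamic programming with an explicitly solvable value function. The observations
reveal only the relative order. Given those up to time `j`, the set of seen ranks is therefore
uniform among the `d`-subsets of `{1, …, n}`, where `d = D_j`, and the remaining applicants are
exchangeable. Repeats of ranks other than the best so far do not matter, so the value of going on
depends only on `d` and on whether the second copy of the best rank so far is still to come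
(`openValue`, W) or not (`closedValue`, V). In the open state this one copy competes with `2(n-d)`
applicants of unseen rank; in the closed state the next new rank is a new best with probability
`1/(d+1)`. Hence `(2(n-d)+1) W(d) = max(d/n, V(d)) + 2(n-d) W(d+1)` and `(d+1) V(d) = W(d+1) + d
V(d+1)`, where `d/n` is the probability that rank 1 has been seen.

With `d/n` in place of the maximum, the solution is `W(d) = (d+2n)/(3n)`, `V(d) = d(α(d)-2)/(3n)`.
These are lower bounds in general (`values_lower`) and exact when `α(d) ≤ 5` (`values_eq`). So `V(d)
≤ d/n` if `α(d) ≤ 5` and `V(d) ≥ d/n` otherwise, which gives the threshold; and `W(d) ≥ d/n`, so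
accepting a first copy is never better than waiting.

Optimality is a martingale argument. On any set of orderings determined by the observations up to
`j`, `offerValue` at `j+1` averages to `rejectValue` at `j` (`Saturated.sum_offerValue_succ`).
Summing up to the stopping time (`IsRule.sum_increments`) bounds every winning probability by
`V(0)`, and the threshold rule has equality throughout. All of this is counting in the finite set of
orderings; `exists_isRule` transfers it to the probability space. -/

/-! ### Recursions for distinct values, relative ranks and copies of the minimum. -/

/-- The set of the values `r 1, …, r j`. -/
def seen (r : ℕ → ℕ) (j : ℕ) : Finset ℕ := (Finset.Icc 1 j).image r

theorem numDistinct_eq_card_seen (r : ℕ → ℕ) (j : ℕ) : numDistinct r j = (seen r j).card := rfl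

theorem Icc_one_succ (j : ℕ) : Finset.Icc 1 (j + 1) = insert (j + 1) (Finset.Icc 1 j) := by
  ext i
  simp only [Finset.mem_Icc, Finset.mem_insert]
  omega

theorem mem_seen {r : ℕ → ℕ} {j x : ℕ} : x ∈ seen r j ↔ ∃ i, (1 ≤ i ∧ i ≤ j) ∧ r i = x := by
  simp [seen]

theorem seen_succ (r : ℕ → ℕ) (j : ℕ) : seen r (j + 1) = insert (r (j + 1)) (seen r j) := by
  simp [seen, Icc_one_succ, Finset.image_insert]

theorem seen_congr {r r' : ℕ → ℕ} {j : ℕ} (h : ∀ i ∈ Finset.Icc 1 j, r i = r' i) :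
    seen r j = seen r' j :=
  Finset.image_congr fun i hi => h i hi

theorem seen_mono (r : ℕ → ℕ) {i j : ℕ} (h : i ≤ j) : seen r i ⊆ seen r j :=
  Finset.image_subset_image (Finset.Icc_subset_Icc_right h)

theorem seen_comp (π r : ℕ → ℕ) (j : ℕ) : seen (π ∘ r) j = (seen r j).image π := by
  simp [seen, Finset.image_image]

theorem numDistinct_succ (r : ℕ → ℕ) (j : ℕ) :
    numDistinct r (j + 1) =
      if r (j + 1) ∈ seen r j then numDistinct r j else numDistinct r j + 1 := by
  rw [numDistinct_eq_card_seen, seen_succ, Finset.card_insert_eq_ite, numDistinct_eq_card_seen]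

theorem relRank_eq_card_filter (r : ℕ → ℕ) (j : ℕ) :
    relRank r j = ((seen r j).filter fun x => x ≤ r j).card := by
  unfold relRank seen
  rw [Finset.filter_image]

theorem relRank_eq_one_iff (r : ℕ → ℕ) {j : ℕ} (hj : 1 ≤ j) :
    relRank r j = 1 ↔ ∀ x ∈ seen r j, r j ≤ x := by
  rw [relRank_eq_card_filter]
  have hmem : r j ∈ (seen r j).filter fun x => x ≤ r j := by
    simp only [Finset.mem_filter, le_refl, and_true]
    exact mem_seen.2 ⟨j, ⟨hj, le_rfl⟩, rfl⟩
  constructor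
  · intro h x hx
    by_contra hlt
    obtain ⟨a, ha⟩ := Finset.card_eq_one.1 h
    have h1 : x ∈ (seen r j).filter fun x => x ≤ r j :=
      Finset.mem_filter.2 ⟨hx, by omega⟩
    rw [ha, Finset.mem_singleton] at hmem h1
    omega
  · intro h
    refine Finset.card_eq_one.2 ⟨r j, ?_⟩
    refine Finset.eq_singleton_iff_unique_mem.2 ⟨hmem, fun x hx => ?_⟩
    rw [Finset.mem_filter] at hx
    exact le_antisymm hx.2 (h x hx.1)

theorem relRank_succ_eq_one_iff (r : ℕ → ℕ) (j : ℕ) :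
    relRank r (j + 1) = 1 ↔ ∀ x ∈ seen r j, r (j + 1) ≤ x := by
  rw [relRank_eq_one_iff r (Nat.le_add_left 1 j), seen_succ]
  simp

theorem bestCount_eq (r : ℕ → ℕ) (j : ℕ) :
    bestCount r j = ((Finset.Icc 1 j).filter fun i => ∀ x ∈ seen r j, r i ≤ x).card := by
  unfold bestCount
  congr 1
  ext i
  simp only [Finset.mem_filter, mem_seen]
  grind

theorem bestCount_succ (r : ℕ → ℕ) (j : ℕ) :
    bestCount r (j + 1) =
      if ∀ x ∈ seen r j, r (j + 1) ≤ x then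
        if r (j + 1) ∈ seen r j then bestCount r j + 1 else 1
      else bestCount r j := by
  rw [bestCount_eq, bestCount_eq, Icc_one_succ, seen_succ]
  have hs : ∀ i ∈ Finset.Icc 1 j, r i ∈ seen r j := fun i hi =>
    Finset.mem_image_of_mem r hi
  have hj : j + 1 ∉ Finset.Icc 1 j := by simp
  split_ifs with h1 h2
  · rw [Finset.filter_insert, if_pos (by simpa using h1), Finset.card_insert_of_notMem (by simp)]
    congr 2
    ext i
    grind
  · rw [Finset.filter_insert, if_pos (by simpa using h1), Finset.card_insert_of_notMem (by simp)]
    rw [Nat.add_eq_right, Finset.card_eq_zero, Finset.filter_eq_empty_iff]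
    intro i hi h
    have := h1 _ (hs i hi)
    have := h _ (Finset.mem_insert_self _ _)
    have h3 : r i = r (j + 1) := by omega
    exact h2 (h3 ▸ hs i hi)
  · rw [Finset.filter_insert, if_neg (by simpa using h1)]
    congr 1
    push Not at h1
    obtain ⟨x, hx, hlt⟩ := h1
    ext i
    grind

theorem bestCount_zero (r : ℕ → ℕ) : bestCount r 0 = 0 := by simp [bestCount]

theorem numDistinct_zero (r : ℕ → ℕ) : numDistinct r 0 = 0 := by simp [numDistinct]

theorem relRank_zero (r : ℕ → ℕ) : relRank r 0 = 0 := by simp [relRank]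

/-- When `X = 1`, an unchanged `D` tells a repeat of the minimum from a new minimum. Hence `S` is a
function of the observations, which makes the threshold rule admissible. -/
theorem bestCount_succ_eq_ite (r : ℕ → ℕ) (j : ℕ) :
    bestCount r (j + 1) =
      if relRank r (j + 1) = 1 then
        if numDistinct r (j + 1) = numDistinct r j then bestCount r j + 1 else 1
      else bestCount r j := by
  rw [bestCount_succ]
  simp only [relRank_succ_eq_one_iff, numDistinct_succ]
  grind

theorem one_le_bestCount (r : ℕ → ℕ) {j : ℕ} (hj : 1 ≤ j) : 1 ≤ bestCount r j := by
  induction j, hj using Nat.le_induction with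
  | base => simp [bestCount_succ, seen]
  | succ j hj ih =>
    rw [bestCount_succ]
    split_ifs <;> omega

theorem numDistinct_congr {r r' : ℕ → ℕ} {j : ℕ} (h : ∀ i ∈ Finset.Icc 1 j, r i = r' i) :
    numDistinct r j = numDistinct r' j := by
  rw [numDistinct_eq_card_seen, seen_congr h, numDistinct_eq_card_seen]

theorem relRank_congr {r r' : ℕ → ℕ} {j : ℕ} (h : ∀ i ∈ Finset.Icc 1 j, r i = r' i) :
    relRank r j = relRank r' j := by
  rcases Nat.eq_zero_or_pos j with rfl | hj
  · simp [relRank_zero]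
  · rw [relRank_eq_card_filter, seen_congr h, relRank_eq_card_filter,
      h j (Finset.mem_Icc.2 ⟨hj, le_rfl⟩)]

/-! ### Sequences with equal observations. -/

/-- Two sequences are indistinguishable up to time `j` if their relative ranks and numbers of
distinct values agree up to that time. -/
def SameObs (j : ℕ) (r r' : ℕ → ℕ) : Prop :=
  ∀ i ≤ j, relRank r i = relRank r' i ∧ numDistinct r i = numDistinct r' i

theorem SameObs.mono {i j : ℕ} {r r' : ℕ → ℕ} (h : SameObs j r r') (hij : i ≤ j) :
    SameObs i r r' := fun k hk => h k (hk.trans hij)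

theorem SameObs.symm {j : ℕ} {r r' : ℕ → ℕ} (h : SameObs j r r') : SameObs j r' r :=
  fun k hk => ⟨(h k hk).1.symm, (h k hk).2.symm⟩

theorem sameObs_of_eqOn {r r' : ℕ → ℕ} {j : ℕ} (h : ∀ i ∈ Finset.Icc 1 j, r i = r' i) :
    SameObs j r r' := fun i hi => by
  have h' : ∀ k ∈ Finset.Icc 1 i, r k = r' k := fun k hk =>
    h k (Finset.Icc_subset_Icc_right hi hk)
  exact ⟨relRank_congr h', numDistinct_congr h'⟩

theorem SameObs.bestCount_eq {j : ℕ} {r r' : ℕ → ℕ} (h : SameObs j r r') :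
    bestCount r j = bestCount r' j := by
  induction j with
  | zero => simp [bestCount_zero]
  | succ j ih =>
    rw [bestCount_succ_eq_ite, bestCount_succ_eq_ite, (h (j + 1) le_rfl).1, (h (j + 1) le_rfl).2,
      (h j (Nat.le_succ j)).2, ih (h.mono (Nat.le_succ j))]

/-- Only the order pattern of the seen ranks enters the observations, so a monotone relabelling is
invisible. This is the source of the uniformity of the seen set. -/
theorem sameObs_comp_of_strictMonoOn {π r : ℕ → ℕ} {j : ℕ}
    (hπ : StrictMonoOn π (seen r j : Set ℕ)) : SameObs j (π ∘ r) r := by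
  intro i hi
  have hsub := seen_mono r hi
  have hinj : Set.InjOn π (seen r i : Set ℕ) :=
    hπ.injOn.mono (Finset.coe_subset.2 hsub)
  constructor
  · rcases Nat.eq_zero_or_pos i with rfl | hpos
    · simp [relRank_zero]
    · have hri : r i ∈ seen r j := hsub (mem_seen.2 ⟨i, ⟨hpos, le_rfl⟩, rfl⟩)
      rw [relRank_eq_card_filter, relRank_eq_card_filter, seen_comp, Finset.filter_image]
      rw [Finset.card_image_of_injOn (hinj.mono (Finset.coe_subset.2 (Finset.filter_subset _ _)))]
      congr 1
      refine Finset.filter_congr fun x hx => ?_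
      exact hπ.le_iff_le (hsub hx) hri
  · rw [numDistinct_eq_card_seen, seen_comp, Finset.card_image_of_injOn hinj,
      numDistinct_eq_card_seen]

/-! ### The finite sample space of orderings. -/

/-- A map `Fin (2n) → Fin n` as a sequence of ranks in `{1, …, n}` at times `1, …, 2n`. -/
def toSeq {n : ℕ} (f : Fin (2 * n) → Fin n) (j : ℕ) : ℕ :=
  if h : 1 ≤ j ∧ j ≤ 2 * n then (f ⟨j - 1, by omega⟩ : ℕ) + 1 else 0

/-- The maps which take every value twice. -/
def twoToOne (n : ℕ) : Finset (Fin (2 * n) → Fin n) :=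
  Finset.univ.filter fun f => ∀ k, Fintype.card {i // f i = k} = 2

theorem toSeq_injective (n : ℕ) : Function.Injective (toSeq (n := n)) := by
  intro f g h
  funext i
  have := congrFun h (i + 1)
  have hi : 1 ≤ (i : ℕ) + 1 ∧ (i : ℕ) + 1 ≤ 2 * n := by omega
  simp only [toSeq, dif_pos hi, Nat.add_sub_cancel, Fin.eta] at this
  exact Fin.ext (by omega)

/-- The orderings of `1, 1, …, n, n`, as sequences that vanish outside of `1, …, 2n`. -/
def orderings (n : ℕ) : Finset (ℕ → ℕ) := (twoToOne n).map ⟨toSeq, toSeq_injective n⟩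

theorem card_fiber_toSeq {n : ℕ} (f : Fin (2 * n) → Fin n) (k : Fin n) :
    ((Finset.Icc 1 (2 * n)).filter fun j => toSeq f j = k + 1).card =
      Fintype.card {i // f i = k} := by
  rw [Fintype.card_subtype]
  refine (Finset.card_nbij (fun i : Fin (2 * n) => (i : ℕ) + 1) ?_ ?_ ?_).symm
  · intro i hi
    have h : 1 ≤ (i : ℕ) + 1 ∧ (i : ℕ) + 1 ≤ 2 * n := by omega
    simp only [Finset.coe_filter, Finset.mem_univ, true_and, Set.mem_ofPred_eq] at hi
    simp only [Finset.coe_filter, Finset.mem_Icc, Set.mem_ofPred_eq]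
    refine ⟨h, ?_⟩
    simp [toSeq, hi]
  · intro i _ i' _ h
    exact Fin.ext (by simpa using h)
  · intro j hj
    simp only [Finset.coe_filter, Finset.mem_Icc, Set.mem_ofPred_eq] at hj
    refine ⟨⟨j - 1, by omega⟩, ?_, by simp; omega⟩
    have h2 := hj.2
    simp only [toSeq, dif_pos hj.1] at h2
    simp only [Finset.coe_filter, Finset.mem_univ, true_and, Set.mem_ofPred_eq]
    exact Fin.ext (by omega)

theorem mem_orderings {n : ℕ} {σ : ℕ → ℕ} :
    σ ∈ orderings n ↔ IsOrdering n σ ∧ ∀ j ∉ Finset.Icc 1 (2 * n), σ j = 0 := by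
  simp only [orderings, Finset.mem_map, Function.Embedding.coeFn_mk, twoToOne, Finset.mem_filter,
    Finset.mem_univ, true_and]
  constructor
  · rintro ⟨f, hf, rfl⟩
    refine ⟨⟨fun j hj => ?_, fun k hk => ?_⟩, fun j hj => ?_⟩
    · rw [Finset.mem_Icc] at hj
      simp only [toSeq, dif_pos hj, Finset.mem_Icc]
      omega
    · rw [Finset.mem_Icc] at hk
      have := card_fiber_toSeq f ⟨k - 1, by omega⟩
      rw [hf] at this
      simpa [Nat.sub_add_cancel hk.1] using this
    · rw [Finset.mem_Icc] at hj
      simp [toSeq, dif_neg hj]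
  · rintro ⟨⟨h1, h2⟩, h3⟩
    have h1' : ∀ i : Fin (2 * n), 1 ≤ σ (i + 1) ∧ σ (i + 1) ≤ n := fun i =>
      Finset.mem_Icc.1 (h1 _ (Finset.mem_Icc.2 (by omega)))
    let f : Fin (2 * n) → Fin n := fun i => ⟨σ (i + 1) - 1, by have := h1' i; omega⟩
    have hf : toSeq f = σ := by
      funext j
      by_cases hj : 1 ≤ j ∧ j ≤ 2 * n
      · have := Finset.mem_Icc.1 (h1 j (Finset.mem_Icc.2 hj))
        simp only [toSeq, dif_pos hj, f, Nat.sub_add_cancel hj.1, Nat.sub_add_cancel this.1]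
      · rw [toSeq, dif_neg hj, h3 j (by rwa [Finset.mem_Icc])]
    refine ⟨f, fun k => ?_, hf⟩
    rw [← card_fiber_toSeq, hf]
    exact h2 _ (Finset.mem_Icc.2 (by omega))

theorem twoToOne_nonempty (n : ℕ) : (twoToOne n).Nonempty := by
  let e : Fin (2 * n) ≃ Fin n × Fin 2 := (finCongr (mul_comm 2 n)).trans finProdFinEquiv.symm
  refine ⟨fun i => (e i).1, ?_⟩
  simp only [twoToOne, Finset.mem_filter, Finset.mem_univ, true_and]
  intro k
  have e1 : {i // (e i).1 = k} ≃ {p : Fin n × Fin 2 // p.1 = k} :=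
    e.subtypeEquiv fun i => Iff.rfl
  have e2 : {p : Fin n × Fin 2 // p.1 = k} ≃ Fin 2 :=
    ⟨fun p => p.1.2, fun x => ⟨(k, x), rfl⟩, fun p => by
      obtain ⟨⟨a, b⟩, h⟩ := p
      simp only at h
      subst h
      rfl, fun x => rfl⟩
  rw [Fintype.card_congr (e1.trans e2), Fintype.card_fin]

/-- Orbit–stabilizer: permutations of the positions act transitively on the two-to-one maps, and a
stabilizer is a product of `n` symmetric groups on two points. -/
theorem card_twoToOne (n : ℕ) : (twoToOne n).card * 2 ^ n = (2 * n).factorial := by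
  classical
  obtain ⟨f, hf⟩ := twoToOne_nonempty n
  have hf' : ∀ k, Fintype.card {i // f i = k} = 2 := by simpa [twoToOne] using hf
  have horb : MulAction.orbit (Equiv.Perm (Fin (2 * n)))ᵈᵐᵃ f = (twoToOne n : Set _) := by
    ext g
    simp only [twoToOne, Finset.coe_filter, Finset.mem_univ, true_and, Set.mem_ofPred_eq]
    constructor
    · rintro ⟨e, rfl⟩ k
      refine (Fintype.card_congr ((DomMulAct.mk.symm e).subtypeEquiv fun i => ?_)).trans (hf' k)
      rfl
    · intro hg
      have e : ∀ k, {i // g i = k} ≃ {i // f i = k} := fun k =>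
        Fintype.equivOfCardEq (by rw [hg, hf'])
      refine ⟨DomMulAct.mk (Equiv.ofFiberEquiv e), ?_⟩
      funext i
      exact Equiv.ofFiberEquiv_map e i
  have hs : Nat.card (MulAction.stabilizer (Equiv.Perm (Fin (2 * n)))ᵈᵐᵃ f) = 2 ^ n := by
    rw [Nat.card_congr MulOpposite.opEquiv,
      Nat.card_congr (DomMulAct.stabilizerMulEquiv f).toEquiv, Nat.card_pi]
    simp [Nat.card_eq_fintype_card, Fintype.card_perm, hf']
  have ho : Nat.card (MulAction.orbit (Equiv.Perm (Fin (2 * n)))ᵈᵐᵃ f) = (twoToOne n).card := by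
    rw [horb]
    simp
  rw [← ho, ← hs, ← Nat.card_prod,
    Nat.card_congr (MulAction.orbitProdStabilizerEquivGroup (Equiv.Perm (Fin (2 * n)))ᵈᵐᵃ f),
    Nat.card_congr DomMulAct.mk.symm, Nat.card_eq_fintype_card, Fintype.card_perm,
    Fintype.card_fin]

theorem card_orderings (n : ℕ) : (orderings n).card * 2 ^ n = (2 * n).factorial := by
  rw [orderings, Finset.card_map, card_twoToOne]

theorem comp_swap_mem_orderings {n : ℕ} {σ : ℕ → ℕ} (hσ : σ ∈ orderings n) {a b : ℕ}
    (ha : a ∈ Finset.Icc 1 (2 * n)) (hb : b ∈ Finset.Icc 1 (2 * n)) :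
    σ ∘ Equiv.swap a b ∈ orderings n := by
  rw [mem_orderings] at hσ ⊢
  obtain ⟨⟨h1, h2⟩, h3⟩ := hσ
  have hmem : ∀ j, Equiv.swap a b j ∈ Finset.Icc 1 (2 * n) ↔ j ∈ Finset.Icc 1 (2 * n) := by
    intro j
    rw [Equiv.swap_apply_def]
    split_ifs with h h'
    · simp only [h, ha, hb]
    · simp only [h', ha, hb]
    · rfl
  refine ⟨⟨fun j hj => h1 _ ((hmem j).2 hj), fun k hk => ?_⟩, fun j hj => h3 _ (by rwa [hmem])⟩
  refine (Finset.card_nbij' (Equiv.swap a b) (Equiv.swap a b) ?_ ?_ ?_ ?_).trans (h2 k hk)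
  · intro j hj
    simp only [Finset.mem_coe, Finset.mem_filter, Function.comp_apply] at hj ⊢
    exact ⟨(hmem j).2 hj.1, hj.2⟩
  · intro j hj
    simp only [Finset.mem_coe, Finset.mem_filter, Function.comp_apply] at hj ⊢
    exact ⟨(hmem j).2 hj.1, by simpa using hj.2⟩
  · intro j _; simp
  · intro j _; simp

theorem perm_comp_mem_orderings {n : ℕ} {σ : ℕ → ℕ} (hσ : σ ∈ orderings n) (π : Equiv.Perm ℕ)
    (hπ : ∀ x, π x ∈ Finset.Icc 1 n ↔ x ∈ Finset.Icc 1 n) (h0 : π 0 = 0) :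
    π ∘ σ ∈ orderings n := by
  rw [mem_orderings] at hσ ⊢
  obtain ⟨⟨h1, h2⟩, h3⟩ := hσ
  refine ⟨⟨fun j hj => (hπ _).2 (h1 j hj), fun k hk => ?_⟩, fun j hj => by simp [h3 j hj, h0]⟩
  refine Eq.trans ?_ (h2 (π.symm k) ((hπ _).1 (by simpa using hk)))
  congr 1
  ext j
  simp [Equiv.eq_symm_apply]

theorem seen_subset {n : ℕ} {σ : ℕ → ℕ} (hσ : σ ∈ orderings n) {j : ℕ} (hj : j ≤ 2 * n) :
    seen σ j ⊆ Finset.Icc 1 n := by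
  intro x hx
  obtain ⟨i, hi, rfl⟩ := mem_seen.1 hx
  exact (mem_orderings.1 hσ).1.1 i (Finset.mem_Icc.2 (by omega))

/-! ### Conditional exchangeability and uniformity given the observations. -/

/-- A set of orderings that is determined by the observations up to time `j`. -/
def Saturated (n j : ℕ) (A : Finset (ℕ → ℕ)) : Prop :=
  A ⊆ orderings n ∧ ∀ σ ∈ A, ∀ σ' ∈ orderings n, SameObs j σ σ' → σ' ∈ A

theorem Saturated.filter {n j : ℕ} {A : Finset (ℕ → ℕ)} (hA : Saturated n j A)
    {p : (ℕ → ℕ) → Prop} [DecidablePred p] (hp : ∀ σ σ', SameObs j σ σ' → p σ → p σ') :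
    Saturated n j (A.filter p) := by
  refine ⟨(Finset.filter_subset _ _).trans hA.1, fun σ hσ σ' hσ' h => ?_⟩
  rw [Finset.mem_filter] at hσ ⊢
  exact ⟨hA.2 σ hσ.1 σ' hσ' h, hp σ σ' h hσ.2⟩

/-- Given the observations up to time `j`, all later times are exchangeable. -/
theorem Saturated.card_filter_swap {n j : ℕ} {A : Finset (ℕ → ℕ)} (hA : Saturated n j A)
    (Q : Finset ℕ → ℕ → Prop) [∀ T, DecidablePred (Q T)] {i i' : ℕ}
    (hi : i ∈ Finset.Ioc j (2 * n)) (hi' : i' ∈ Finset.Ioc j (2 * n)) :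
    (A.filter fun σ => Q (seen σ j) (σ i)).card =
      (A.filter fun σ => Q (seen σ j) (σ i')).card := by
  rw [Finset.mem_Ioc] at hi hi'
  have hfix : ∀ σ : ℕ → ℕ, ∀ k ∈ Finset.Icc 1 j, σ k = (σ ∘ Equiv.swap i i') k := by
    intro σ k hk
    rw [Finset.mem_Icc] at hk
    rw [Function.comp_apply, Equiv.swap_apply_of_ne_of_ne (by omega) (by omega)]
  have hmem : ∀ σ ∈ A, σ ∘ Equiv.swap i i' ∈ A := fun σ hσ =>
    hA.2 σ hσ _ (comp_swap_mem_orderings (hA.1 hσ) (Finset.mem_Icc.2 (by omega))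
      (Finset.mem_Icc.2 (by omega))) (sameObs_of_eqOn (hfix σ))
  have hinv : ∀ σ : ℕ → ℕ, (σ ∘ Equiv.swap i i') ∘ Equiv.swap i i' = σ := fun σ => by
    funext k
    simp
  refine Finset.card_nbij' (· ∘ Equiv.swap i i') (· ∘ Equiv.swap i i') ?_ ?_
    (fun σ _ => hinv σ) (fun σ _ => hinv σ)
  · intro σ hσ
    simp only [Finset.mem_coe, Finset.mem_filter] at hσ ⊢
    refine ⟨hmem σ hσ.1, ?_⟩
    rw [← seen_congr (hfix σ)]
    simpa using hσ.2
  · intro σ hσ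
    simp only [Finset.mem_coe, Finset.mem_filter] at hσ ⊢
    refine ⟨hmem σ hσ.1, ?_⟩
    rw [← seen_congr (hfix σ)]
    simpa using hσ.2

/-- Double counting of pairs `(i, σ)` with `i > j`: by exchangeability every later time `i`
contributes as much as `j + 1`. -/
theorem Saturated.mul_card_filter_next {n j : ℕ} {A : Finset (ℕ → ℕ)} (hA : Saturated n j A)
    (hj : j < 2 * n) (Q : Finset ℕ → ℕ → Prop) [∀ T, DecidablePred (Q T)] :
    (2 * n - j) * (A.filter fun σ => Q (seen σ j) (σ (j + 1))).card =
      ∑ σ ∈ A, ((Finset.Ioc j (2 * n)).filter fun i => Q (seen σ j) (σ i)).card := by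
  have h : ∀ i ∈ Finset.Ioc j (2 * n), (A.filter fun σ => Q (seen σ j) (σ i)).card =
      (A.filter fun σ => Q (seen σ j) (σ (j + 1))).card := fun i hi =>
    hA.card_filter_swap Q hi (Finset.mem_Ioc.2 (by omega))
  rw [← Nat.card_Ioc, ← smul_eq_mul, ← Finset.sum_const, ← Finset.sum_congr rfl h]
  exact Finset.sum_card_bipartiteAbove_eq_sum_card_bipartiteBelow
    (fun i σ => Q (seen σ j) (σ i))

/-- A permutation of the ranks that maps `T` onto `T'` monotonically. -/
theorem exists_perm_strictMonoOn {n : ℕ} {T T' : Finset ℕ} (hT : T ⊆ Finset.Icc 1 n)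
    (hT' : T' ⊆ Finset.Icc 1 n) (hc : T.card = T'.card) :
    ∃ π : Equiv.Perm ℕ, (∀ x, π x ∈ Finset.Icc 1 n ↔ x ∈ Finset.Icc 1 n) ∧ π 0 = 0 ∧
      StrictMonoOn π (T : Set ℕ) ∧ T.image π = T' := by
  classical
  let e : T ≃o T' := (T.orderIsoOfFin rfl).symm.trans (T'.orderIsoOfFin hc.symm)
  let I : Type := {x // x ∈ Finset.Icc 1 n}
  have : Fintype I := inferInstanceAs (Fintype {x // x ∈ Finset.Icc 1 n})
  let e1 : {x : I // (x : ℕ) ∈ T} ≃ T :=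
    ⟨fun x => ⟨x.1, x.2⟩, fun x => ⟨⟨x.1, hT x.2⟩, x.2⟩, fun _ => rfl, fun _ => rfl⟩
  let e2 : {x : I // (x : ℕ) ∈ T'} ≃ T' :=
    ⟨fun x => ⟨x.1, x.2⟩, fun x => ⟨⟨x.1, hT' x.2⟩, x.2⟩, fun _ => rfl, fun _ => rfl⟩
  let E : {x : I // (x : ℕ) ∈ T} ≃ {x : I // (x : ℕ) ∈ T'} :=
    (e1.trans e.toEquiv).trans e2.symm
  let ρ : Equiv.Perm I := E.extendSubtype
  let π : Equiv.Perm ℕ := Equiv.Perm.ofSubtype ρ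
  have hval : ∀ x (hx : x ∈ T), π x = e ⟨x, hx⟩ := by
    intro x hx
    have h1 : π x = ρ ⟨x, hT hx⟩ := Equiv.Perm.ofSubtype_apply_of_mem ρ (hT hx)
    rw [h1]
    have h2 : ρ ⟨x, hT hx⟩ = E ⟨⟨x, hT hx⟩, hx⟩ :=
      Equiv.extendSubtype_apply_of_mem E ⟨x, hT hx⟩ hx
    rw [h2]
    rfl
  refine ⟨π, ?_, ?_, ?_, ?_⟩
  · intro x
    exact Equiv.Perm.ofSubtype_apply_mem_iff_mem ρ x
  · exact Equiv.Perm.ofSubtype_apply_of_not_mem ρ (by simp)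
  · intro x hx y hy hxy
    rw [hval x hx, hval y hy]
    exact e.strictMono hxy
  · ext y
    simp only [Finset.mem_image]
    constructor
    · rintro ⟨x, hx, rfl⟩
      rw [hval x hx]
      exact (e ⟨x, hx⟩).2
    · intro hy
      refine ⟨e.symm ⟨y, hy⟩, (e.symm ⟨y, hy⟩).2, ?_⟩
      rw [hval _ (e.symm ⟨y, hy⟩).2]
      simp

/-- A relabelling of the ranks that maps `T` monotonically onto `T'` preserves the observations,
hence `A`, and injects one fibre into the other. -/
theorem Saturated.card_seen_le {n j : ℕ} {A : Finset (ℕ → ℕ)} (hA : Saturated n j A)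
    {T T' : Finset ℕ} (hT : T ⊆ Finset.Icc 1 n) (hT' : T' ⊆ Finset.Icc 1 n)
    (hc : T.card = T'.card) :
    (A.filter fun σ => seen σ j = T).card ≤ (A.filter fun σ => seen σ j = T').card := by
  obtain ⟨π, h1, h2, h3, h4⟩ := exists_perm_strictMonoOn hT hT' hc
  refine Finset.card_le_card_of_injOn (π ∘ ·) ?_ ?_
  · intro σ hσ
    simp only [Finset.mem_coe, Finset.mem_filter] at hσ ⊢
    obtain ⟨hσA, hσT⟩ := hσ
    refine ⟨hA.2 σ hσA _ (perm_comp_mem_orderings (hA.1 hσA) π h1 h2) ?_, ?_⟩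
    · exact (sameObs_comp_of_strictMonoOn (by rwa [hσT])).symm
    · rw [seen_comp, hσT, h4]
  · intro σ _ σ' _ h
    exact π.injective.comp_left h

/-- Given the observations up to time `j`, all sets of ranks of the right size are equally
likely. -/
theorem Saturated.sum_seen_mul_choose {n j d : ℕ} {A : Finset (ℕ → ℕ)} (hA : Saturated n j A)
    (hj : j ≤ 2 * n) (hd : ∀ σ ∈ A, numDistinct σ j = d) (f : Finset ℕ → ℕ) :
    (∑ σ ∈ A, f (seen σ j)) * n.choose d =
      A.card * ∑ T ∈ Finset.powersetCard d (Finset.Icc 1 n), f T := by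
  have hmaps : ∀ σ ∈ A, seen σ j ∈ Finset.powersetCard d (Finset.Icc 1 n) := fun σ hσ =>
    Finset.mem_powersetCard.2 ⟨seen_subset (hA.1 hσ) hj, hd σ hσ⟩
  rcases A.eq_empty_or_nonempty with rfl | ⟨σ₀, hσ₀⟩
  · simp
  have h0 := hmaps σ₀ hσ₀
  have hc : ∀ T ∈ Finset.powersetCard d (Finset.Icc 1 n),
      (A.filter fun σ => seen σ j = T).card = (A.filter fun σ => seen σ j = seen σ₀ j).card := by
    intro T hT
    rw [Finset.mem_powersetCard] at hT h0
    exact le_antisymm (hA.card_seen_le hT.1 h0.1 (hT.2.trans h0.2.symm))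
      (hA.card_seen_le h0.1 hT.1 (h0.2.trans hT.2.symm))
  set c := (A.filter fun σ => seen σ j = seen σ₀ j).card
  have hA' : A.card = n.choose d * c := by
    rw [Finset.card_eq_sum_card_fiberwise hmaps, Finset.sum_congr rfl hc, Finset.sum_const,
      Finset.card_powersetCard, Nat.card_Icc, Nat.add_sub_cancel, smul_eq_mul]
  have hs : ∑ σ ∈ A, f (seen σ j) = c * ∑ T ∈ Finset.powersetCard d (Finset.Icc 1 n), f T := by
    rw [← Finset.sum_fiberwise_of_maps_to hmaps, Finset.mul_sum]
    refine Finset.sum_congr rfl fun T hT => ?_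
    rw [← hc T hT, ← smul_eq_mul, ← Finset.sum_const]
    refine Finset.sum_congr rfl fun σ hσ => ?_
    rw [(Finset.mem_filter.1 hσ).2]
  rw [hs, hA']
  ring

/-! ### The value functions and the threshold. -/

/-- Optimal continuation values with `m` unseen ranks: the first component if the copies of the
best rank so far are used up, the second if one copy of it is still to come. -/
noncomputable def contValue (n : ℕ) : ℕ → ℝ × ℝ
  -- Once all ranks are seen the best one is rank 1, so a copy still to come is a sure win.
  | 0 => (0, 1)
  | m + 1 =>
    let p := contValue n m
    -- Here `d = n - m - 1`: the next new rank is a new best with probability `1/(d+1)`.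
    let v := (p.2 + ((n : ℝ) - m - 1) * p.1) / ((n : ℝ) - m)
    -- Among the awaited copy and the `2(m+1)` applicants of unseen rank, each is equally likely to
    -- come first. A new rank leads to an open state whether or not it is a new best.
    (v, (max (((n : ℝ) - m - 1) / n) v + 2 * ((m : ℝ) + 1) * p.2) / (2 * ((m : ℝ) + 1) + 1))

/-- Optimal continuation value with `d` ranks seen and both copies of the best of them passed. -/
noncomputable def closedValue (n d : ℕ) : ℝ := (contValue n (n - d)).1

/-- Optimal continuation value with `d` ranks seen and one copy of the best of them to come. -/
noncomputable def openValue (n d : ℕ) : ℝ := (contValue n (n - d)).2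

theorem closedValue_self (n : ℕ) : closedValue n n = 0 := by simp [closedValue, contValue]

theorem openValue_self (n : ℕ) : openValue n n = 1 := by simp [openValue, contValue]

theorem closedValue_rec {n d : ℕ} (h : d < n) :
    ((d : ℝ) + 1) * closedValue n d = openValue n (d + 1) + d * closedValue n (d + 1) := by
  obtain ⟨m, rfl⟩ := Nat.exists_eq_add_of_lt h
  have h1 : d + m + 1 - d = m + 1 := by omega
  have h2 : d + m + 1 - (d + 1) = m := by omega
  simp only [closedValue, openValue, h1, h2, contValue]
  have h3 : ((d + m + 1 : ℕ) : ℝ) - m = d + 1 := by push_cast; ring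
  rw [h3]
  have h4 : (d : ℝ) + 1 ≠ 0 := by positivity
  field_simp
  ring

theorem openValue_rec {n d : ℕ} (h : d < n) :
    (2 * ((n : ℝ) - d) + 1) * openValue n d =
      max ((d : ℝ) / n) (closedValue n d) + 2 * ((n : ℝ) - d) * openValue n (d + 1) := by
  obtain ⟨m, rfl⟩ := Nat.exists_eq_add_of_lt h
  have h1 : d + m + 1 - d = m + 1 := by omega
  have h2 : d + m + 1 - (d + 1) = m := by omega
  simp only [closedValue, openValue, h1, h2, contValue]
  have h3 : ((d + m + 1 : ℕ) : ℝ) - m = d + 1 := by push_cast; ring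
  have h4 : ((d + m + 1 : ℕ) : ℝ) - d = m + 1 := by push_cast; ring
  rw [h3, h4]
  have h5 : 2 * ((m : ℝ) + 1) + 1 ≠ 0 := by positivity
  rw [mul_div_cancel₀ _ h5]
  simp

theorem alpha_succ {n d : ℕ} (hd : 1 ≤ d) (h : d < n) :
    (d : ℝ) * alpha n d = d * alpha n (d + 1) + 2 * n / ((d : ℝ) + 1) + 1 := by
  have hs : Finset.Icc (d + 1) n = insert (d + 1) (Finset.Icc (d + 1 + 1) n) := by
    ext i
    simp only [Finset.mem_Icc, Finset.mem_insert]
    omega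
  have hd' : (0 : ℝ) < d := by exact_mod_cast hd
  unfold alpha
  rw [hs, Finset.sum_insert (by simp)]
  push_cast
  rw [add_sub_cancel_right]
  field_simp
  ring

theorem alpha_self {n : ℕ} (hn : 1 ≤ n) : alpha n n = 2 := by
  have : (n : ℝ) ≠ 0 := by exact_mod_cast (by omega : n ≠ 0)
  simp [alpha, this]

theorem alpha_succ_le {n d : ℕ} (hd : 1 ≤ d) (h : d < n) : alpha n (d + 1) ≤ alpha n d := by
  have hd' : (0 : ℝ) < d := by exact_mod_cast hd
  have := alpha_succ hd h
  have h2 : (0 : ℝ) ≤ 2 * n / ((d : ℝ) + 1) := by positivity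
  nlinarith

theorem alpha_le_of_le {n d e : ℕ} (hd : 1 ≤ d) (hde : d ≤ e) (he : e ≤ n) :
    alpha n e ≤ alpha n d := by
  induction e, hde using Nat.le_induction with
  | base => exact le_rfl
  | succ e hde ih => exact (alpha_succ_le (hd.trans hde) (by omega)).trans (ih (by omega))

theorem threshold_le_iff {n d : ℕ} (hd : 1 ≤ d) (hdn : d ≤ n) :
    threshold n ≤ d ↔ alpha n d ≤ 5 := by
  constructor
  · intro h
    have hmem : threshold n ∈ {i : ℕ | 1 ≤ i ∧ alpha n i ≤ 5} :=
      Nat.sInf_mem ⟨n, hd.trans hdn, by rw [alpha_self (hd.trans hdn)]; norm_num⟩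
    exact (alpha_le_of_le hmem.1 h hdn).trans hmem.2
  · intro h
    exact Nat.sInf_le ⟨hd, h⟩

/-- The two closed forms solve the recursions exactly when the maximum is replaced by `d/n`;
bounding the maximum below by `d/n` gives inequalities by descending induction on `d`. -/
theorem values_lower {n d : ℕ} (hd : 1 ≤ d) (hdn : d ≤ n) :
    ((d : ℝ) + 2 * n) / (3 * n) ≤ openValue n d ∧
      (d : ℝ) / (3 * n) * (alpha n d - 2) ≤ closedValue n d := by
  have hn : (0 : ℝ) < n := by exact_mod_cast hd.trans hdn
  induction hdn using Nat.decreasingInduction with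
  | self =>
    rw [openValue_self, closedValue_self, alpha_self hd]
    constructor
    · rw [div_le_one (by positivity)]; linarith
    · simp
  | of_succ d hdn ih =>
    obtain ⟨ih1, ih2⟩ := ih (by omega)
    have hd' : (0 : ℝ) < d := by exact_mod_cast hd
    have hdn' : (d : ℝ) < n := by exact_mod_cast hdn
    have hv := closedValue_rec hdn
    have hw := openValue_rec hdn
    have ha := alpha_succ hd hdn
    have hm := le_max_left ((d : ℝ) / n) (closedValue n d)
    push_cast at ih1 ih2
    constructor
    · have h1 := mul_le_mul_of_nonneg_left ih1 (by linarith : 0 ≤ 2 * ((n : ℝ) - d))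
      have h2 : (2 * ((n : ℝ) - d) + 1) * (((d : ℝ) + 2 * n) / (3 * n)) =
          (d : ℝ) / n + 2 * ((n : ℝ) - d) * (((d : ℝ) + 1 + 2 * n) / (3 * n)) := by
        field_simp; ring
      refine le_of_mul_le_mul_left (a := 2 * ((n : ℝ) - d) + 1) ?_ (by linarith)
      linarith
    · have h1 := mul_le_mul_of_nonneg_left ih2 hd'.le
      have h2 : ((d : ℝ) + 1) * ((d : ℝ) / (3 * n) * (alpha n d - 2)) =
          ((d : ℝ) + 1 + 2 * n) / (3 * n) +
            d * (((d : ℝ) + 1) / (3 * n) * (alpha n (d + 1) - 2)) := by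
        have : (d : ℝ) / (3 * n) * (alpha n d - 2) = (d * alpha n d - 2 * d) / (3 * n) := by ring
        rw [this, ha]
        field_simp; ring
      refine le_of_mul_le_mul_left (a := (d : ℝ) + 1) ?_ (by linarith)
      linarith

/-- Since `α` decreases, the hypothesis passes to `d + 1`. The formula for V comes first: together
with `α(d) ≤ 5` it shows that the maximum in the recursion for W is `d/n`. -/
theorem values_eq {n d : ℕ} (hd : 1 ≤ d) (hdn : d ≤ n) (hα : alpha n d ≤ 5) :
    openValue n d = ((d : ℝ) + 2 * n) / (3 * n) ∧
      closedValue n d = (d : ℝ) / (3 * n) * (alpha n d - 2) := by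
  have hn : (0 : ℝ) < n := by exact_mod_cast hd.trans hdn
  induction hdn using Nat.decreasingInduction with
  | self =>
    rw [openValue_self, closedValue_self, alpha_self hd]
    constructor
    · field_simp; norm_num
    · simp
  | of_succ d hdn ih =>
    obtain ⟨ih1, ih2⟩ := ih (by omega) ((alpha_succ_le hd hdn).trans hα)
    have hd' : (0 : ℝ) < d := by exact_mod_cast hd
    have hdn' : (d : ℝ) < n := by exact_mod_cast hdn
    have hv := closedValue_rec hdn
    have hw := openValue_rec hdn
    have ha := alpha_succ hd hdn
    push_cast at ih1 ih2
    have hV : closedValue n d = (d : ℝ) / (3 * n) * (alpha n d - 2) := by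
      have : (d : ℝ) / (3 * n) * (alpha n d - 2) = (d * alpha n d - 2 * d) / (3 * n) := by ring
      rw [this, ha]
      refine mul_left_cancel₀ (by positivity : (d : ℝ) + 1 ≠ 0) ?_
      rw [hv, ih1, ih2]
      field_simp; ring
    refine ⟨?_, hV⟩
    have hle : closedValue n d ≤ (d : ℝ) / n := by
      have h1 : (d : ℝ) / (3 * n) * (alpha n d - 2) ≤ (d : ℝ) / (3 * n) * 3 :=
        mul_le_mul_of_nonneg_left (by linarith) (by positivity)
      have h2 : (d : ℝ) / (3 * n) * 3 = d / n := by field_simp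
      linarith
    rw [max_eq_left hle, ih1] at hw
    refine mul_left_cancel₀ (by linarith : 2 * ((n : ℝ) - d) + 1 ≠ 0) ?_
    rw [hw]
    field_simp; ring

theorem div_le_openValue {n d : ℕ} (hd : 1 ≤ d) (hdn : d ≤ n) : (d : ℝ) / n ≤ openValue n d := by
  have hn : (0 : ℝ) < n := by exact_mod_cast hd.trans hdn
  have hdn' : (d : ℝ) ≤ n := by exact_mod_cast hdn
  refine le_trans ?_ (values_lower hd hdn).1
  rw [div_le_div_iff₀ hn (by positivity)]
  nlinarith

theorem closedValue_le_div {n d : ℕ} (hd : 1 ≤ d) (hdn : d ≤ n) (h : threshold n ≤ d) :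
    closedValue n d ≤ (d : ℝ) / n := by
  have hn : (0 : ℝ) < n := by exact_mod_cast hd.trans hdn
  have hα := (threshold_le_iff hd hdn).1 h
  rw [(values_eq hd hdn hα).2]
  have h1 : (d : ℝ) / (3 * n) * (alpha n d - 2) ≤ (d : ℝ) / (3 * n) * 3 :=
    mul_le_mul_of_nonneg_left (by linarith) (by positivity)
  have h2 : (d : ℝ) / (3 * n) * 3 = d / n := by field_simp
  linarith

theorem div_le_closedValue {n d : ℕ} (hd : 1 ≤ d) (hdn : d ≤ n) (h : ¬ threshold n ≤ d) :
    (d : ℝ) / n ≤ closedValue n d := by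
  have hn : (0 : ℝ) < n := by exact_mod_cast hd.trans hdn
  rw [threshold_le_iff hd hdn, not_le] at h
  have h1 : (d : ℝ) / (3 * n) * 3 ≤ (d : ℝ) / (3 * n) * (alpha n d - 2) :=
    mul_le_mul_of_nonneg_left (by linarith) (by positivity)
  have h2 : (d : ℝ) / (3 * n) * 3 = d / n := by field_simp
  linarith [(values_lower hd hdn).2]

theorem closedValue_nonneg {n d : ℕ} (hd : 1 ≤ d) (hdn : d ≤ n) : 0 ≤ closedValue n d := by
  have hα : 2 ≤ alpha n d := by
    rw [← alpha_self (hd.trans hdn)]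
    exact alpha_le_of_le hd hdn le_rfl
  refine le_trans ?_ (values_lower hd hdn).2
  exact mul_nonneg (by positivity) (by linarith)

/-! ### Counting the applicants still to come, and sets of ranks. -/

theorem numDistinct_le {n j : ℕ} {σ : ℕ → ℕ} (hσ : σ ∈ orderings n) (hj : j ≤ 2 * n) :
    numDistinct σ j ≤ n := by
  have := Finset.card_le_card (seen_subset hσ hj)
  rwa [Nat.card_Icc, Nat.add_sub_cancel] at this

theorem one_le_numDistinct (σ : ℕ → ℕ) {j : ℕ} (hj : 1 ≤ j) : 1 ≤ numDistinct σ j :=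
  Finset.card_pos.2 ⟨σ j, mem_seen.2 ⟨j, ⟨hj, le_rfl⟩, rfl⟩⟩

/-- Every unseen rank is still to come twice. -/
theorem card_filter_unseen {n j : ℕ} {σ : ℕ → ℕ} (hσ : σ ∈ orderings n) {Q : Finset ℕ}
    (hQ : Q ⊆ Finset.Icc 1 n) (hd : Disjoint Q (seen σ j)) :
    ((Finset.Ioc j (2 * n)).filter fun i => σ i ∈ Q).card = 2 * Q.card := by
  have hmaps : ∀ i ∈ (Finset.Ioc j (2 * n)).filter (fun i => σ i ∈ Q), σ i ∈ Q := fun i hi =>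
    (Finset.mem_filter.1 hi).2
  rw [Finset.card_eq_sum_card_fiberwise hmaps, mul_comm 2 Q.card, ← smul_eq_mul Q.card 2,
    ← Finset.sum_const]
  refine Finset.sum_congr rfl fun k hk => ?_
  refine Eq.trans ?_ ((mem_orderings.1 hσ).1.2 k (hQ hk))
  congr 1
  ext i
  simp only [Finset.mem_filter, Finset.mem_Ioc, Finset.mem_Icc]
  constructor
  · rintro ⟨⟨h1, _⟩, h3⟩
    exact ⟨by omega, h3⟩
  · rintro ⟨h1, rfl⟩
    refine ⟨⟨⟨?_, h1.2⟩, hk⟩, rfl⟩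
    by_contra hle
    exact Finset.disjoint_left.1 hd hk (mem_seen.2 ⟨i, by omega, rfl⟩)

theorem card_filter_notMem_seen {n j : ℕ} {σ : ℕ → ℕ} (hσ : σ ∈ orderings n) (hj : j ≤ 2 * n) :
    ((Finset.Ioc j (2 * n)).filter fun i => σ i ∉ seen σ j).card =
      2 * (n - numDistinct σ j) := by
  have h := card_filter_unseen (j := j) hσ (Q := Finset.Icc 1 n \ seen σ j)
    Finset.sdiff_subset Finset.sdiff_disjoint
  rw [Finset.card_sdiff_of_subset (seen_subset hσ hj), Nat.card_Icc, Nat.add_sub_cancel,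
    ← numDistinct_eq_card_seen] at h
  rw [← h]
  congr 1
  refine Finset.filter_congr fun i hi => ?_
  rw [Finset.mem_Ioc] at hi
  rw [Finset.mem_sdiff, and_iff_right]
  exact (mem_orderings.1 hσ).1.1 i (Finset.mem_Icc.2 (by omega))

theorem card_filter_lt_seen {n j : ℕ} {σ : ℕ → ℕ} (hσ : σ ∈ orderings n) :
    ((Finset.Ioc j (2 * n)).filter fun i => ∀ x ∈ seen σ j, σ i < x).card =
      2 * ((Finset.Icc 1 n).filter fun k => ∀ x ∈ seen σ j, k < x).card := by
  have hd : Disjoint ((Finset.Icc 1 n).filter fun k => ∀ x ∈ seen σ j, k < x) (seen σ j) :=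
    Finset.disjoint_left.2 fun k hk hk' => lt_irrefl k ((Finset.mem_filter.1 hk).2 k hk')
  rw [← card_filter_unseen hσ (Finset.filter_subset _ _) hd]
  congr 1
  refine Finset.filter_congr fun i hi => ?_
  rw [Finset.mem_Ioc] at hi
  rw [Finset.mem_filter, and_iff_right]
  exact (mem_orderings.1 hσ).1.1 i (Finset.mem_Icc.2 (by omega))

/-- The best rank so far occurs twice in total. -/
theorem card_filter_best_add_bestCount {n j : ℕ} {σ : ℕ → ℕ} (hσ : σ ∈ orderings n) (hj : 1 ≤ j)
    (hjn : j ≤ 2 * n) :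
    ((Finset.Ioc j (2 * n)).filter fun i =>
      σ i ∈ seen σ j ∧ ∀ x ∈ seen σ j, σ i ≤ x).card + bestCount σ j = 2 := by
  have hne : (seen σ j).Nonempty := ⟨σ j, mem_seen.2 ⟨j, ⟨hj, le_rfl⟩, rfl⟩⟩
  set m := (seen σ j).min' hne with hm
  have hmem : m ∈ seen σ j := Finset.min'_mem _ _
  have hle : ∀ x ∈ seen σ j, m ≤ x := fun x hx => Finset.min'_le _ _ hx
  have hiff : ∀ y ∈ seen σ j, (∀ x ∈ seen σ j, y ≤ x) ↔ y = m := fun y hy =>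
    ⟨fun h => le_antisymm (h m hmem) (hle y hy), fun h => h ▸ hle⟩
  have h1 : (Finset.Ioc j (2 * n)).filter (fun i => σ i ∈ seen σ j ∧ ∀ x ∈ seen σ j, σ i ≤ x) =
      (Finset.Ioc j (2 * n)).filter fun i => σ i = m := by
    refine Finset.filter_congr fun i _ => ⟨fun h => (hiff _ h.1).1 h.2, fun h => ?_⟩
    rw [h]
    exact ⟨hmem, hle⟩
  have h2 : (Finset.Icc 1 j).filter (fun i => ∀ x ∈ seen σ j, σ i ≤ x) =
      (Finset.Icc 1 j).filter fun i => σ i = m :=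
    Finset.filter_congr fun i hi => hiff _ (Finset.mem_image_of_mem σ hi)
  rw [bestCount_eq, h1, h2, ← Finset.card_union_of_disjoint, ← Finset.filter_union]
  · refine Eq.trans ?_ ((mem_orderings.1 hσ).1.2 m (seen_subset hσ hjn hmem))
    congr 2
    ext i
    simp only [Finset.mem_union, Finset.mem_Ioc, Finset.mem_Icc]
    omega
  · refine Finset.disjoint_left.2 fun i hi hi' => ?_
    simp only [Finset.mem_filter, Finset.mem_Ioc, Finset.mem_Icc] at hi hi'
    omega

theorem bestCount_le_two {n j : ℕ} {σ : ℕ → ℕ} (hσ : σ ∈ orderings n) (hj : j ≤ 2 * n) :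
    bestCount σ j ≤ 2 := by
  rcases Nat.eq_zero_or_pos j with rfl | h
  · simp [bestCount_zero]
  · have := card_filter_best_add_bestCount hσ h hj
    omega

/-- Pairs `(T, k)` with `k` below all of `T` correspond to the `(d+1)`-sets `insert k T`, from which
`k` is recovered as the minimum. -/
theorem sum_powersetCard_card_lt (n d : ℕ) :
    ∑ T ∈ Finset.powersetCard d (Finset.Icc 1 n),
      ((Finset.Icc 1 n).filter fun k => ∀ x ∈ T, k < x).card = n.choose (d + 1) := by
  have hU : n.choose (d + 1) = (Finset.powersetCard (d + 1) (Finset.Icc 1 n)).card := by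
    rw [Finset.card_powersetCard, Nat.card_Icc, Nat.add_sub_cancel]
  rw [hU, ← Finset.card_sigma]
  refine Finset.card_nbij (fun p => insert p.2 p.1) ?_ ?_ ?_
  · rintro ⟨T, k⟩ h
    simp only [Finset.coe_sigma, Set.mem_sigma_iff, Finset.mem_coe, Finset.mem_powersetCard,
      Finset.mem_filter] at h ⊢
    have hk : k ∉ T := fun hk => lt_irrefl k (h.2.2 k hk)
    exact ⟨Finset.insert_subset h.2.1 h.1.1, by rw [Finset.card_insert_of_notMem hk, h.1.2]⟩
  · rintro ⟨T, k⟩ h ⟨T', k'⟩ h' heq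
    simp only [Finset.coe_sigma, Set.mem_sigma_iff, Finset.mem_coe, Finset.mem_powersetCard,
      Finset.mem_filter] at h h' heq
    have hk : k ∉ T := fun hk => lt_irrefl k (h.2.2 k hk)
    have hk' : k' ∉ T' := fun hk => lt_irrefl k' (h'.2.2 k' hk)
    have hkk : k = k' := by
      have h1 : k ∈ insert k' T' := heq ▸ Finset.mem_insert_self k T
      have h2 : k' ∈ insert k T := heq ▸ Finset.mem_insert_self k' T'
      rw [Finset.mem_insert] at h1 h2
      rcases h1 with h1 | h1
      · exact h1
      · rcases h2 with h2 | h2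
        · exact h2.symm
        · exact absurd (h'.2.2 k h1) (lt_asymm (h.2.2 k' h2))
    subst hkk
    have hTT : T = T' := by
      rw [← Finset.erase_insert hk, heq, Finset.erase_insert hk']
    rw [hTT]
  · intro U hUm
    simp only [Finset.mem_coe, Finset.mem_powersetCard] at hUm
    have hne : U.Nonempty := Finset.card_pos.1 (by omega)
    have hm := Finset.min'_mem U hne
    refine ⟨⟨U.erase (U.min' hne), U.min' hne⟩, ?_, Finset.insert_erase hm⟩
    simp only [Finset.coe_sigma, Set.mem_sigma_iff, Finset.mem_coe, Finset.mem_powersetCard,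
      Finset.mem_filter]
    refine ⟨⟨(Finset.erase_subset _ _).trans hUm.1, ?_⟩, hUm.1 hm, fun x hx => ?_⟩
    · rw [Finset.card_erase_of_mem hm, hUm.2, Nat.add_sub_cancel]
    · exact Finset.min'_lt_of_mem_erase_min' U hne hx

theorem mul_card_powersetCard_one_mem {n : ℕ} (hn : 1 ≤ n) (d : ℕ) :
    n * ((Finset.powersetCard d (Finset.Icc 1 n)).filter fun T => 1 ∈ T).card =
      d * n.choose d := by
  -- The sets avoiding 1 are the `d`-subsets of an `(n-1)`-set; Pascal's rule then counts those
  -- containing 1.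
  have h1 : ((Finset.powersetCard d (Finset.Icc 1 n)).filter fun T => 1 ∉ T) =
      Finset.powersetCard d (Finset.Icc 2 n) := by
    ext T
    simp only [Finset.mem_filter, Finset.mem_powersetCard]
    constructor
    · rintro ⟨⟨h1, h2⟩, h3⟩
      refine ⟨fun x hx => ?_, h2⟩
      have := Finset.mem_Icc.1 (h1 hx)
      have hx1 : x ≠ 1 := fun h => h3 (h ▸ hx)
      exact Finset.mem_Icc.2 (by omega)
    · rintro ⟨h1, h2⟩
      refine ⟨⟨h1.trans (Finset.Icc_subset_Icc_left (by omega)), h2⟩, fun h => ?_⟩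
      simpa using h1 h
  have h2 := Finset.card_filter_add_card_filter_not
    (s := Finset.powersetCard d (Finset.Icc 1 n)) (fun T => 1 ∈ T)
  rw [h1, Finset.card_powersetCard, Finset.card_powersetCard, Nat.card_Icc, Nat.card_Icc,
    Nat.add_sub_cancel] at h2
  obtain ⟨m, rfl⟩ := Nat.exists_eq_add_of_le' hn
  have h3 : m + 1 + 1 - 2 = m := by omega
  rw [h3] at h2
  rcases d with _ | d
  · simp
  · rw [Nat.choose_succ_succ'] at h2
    have h4 : ((Finset.powersetCard (d + 1) (Finset.Icc 1 (m + 1))).filter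
        fun T => 1 ∈ T).card = m.choose d := by omega
    rw [h4, Nat.add_one_mul_choose_eq, mul_comm]

/-! ### One-step transition probabilities, with denominators cleared. -/

section Transition

variable {n j d : ℕ} {A : Finset (ℕ → ℕ)}

theorem Saturated.mul_card_new (hA : Saturated n j A) (hj : j < 2 * n)
    (hd : ∀ σ ∈ A, numDistinct σ j = d) :
    (2 * n - j) * (A.filter fun σ => σ (j + 1) ∉ seen σ j).card = A.card * (2 * (n - d)) := by
  rw [hA.mul_card_filter_next hj fun T k => k ∉ T, ← smul_eq_mul A.card, ← Finset.sum_const]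
  refine Finset.sum_congr rfl fun σ hσ => ?_
  rw [card_filter_notMem_seen (hA.1 hσ) hj.le, hd σ hσ]

/-- For a uniform seen set, the mean number of ranks below all seen ones is `C(n,d+1)/C(n,d) =
(n-d)/(d+1)`, and each of them is still to come twice. -/
theorem Saturated.mul_card_newBest (hA : Saturated n j A) (hj : j < 2 * n)
    (hd : ∀ σ ∈ A, numDistinct σ j = d) (hdn : d ≤ n) :
    (2 * n - j) * ((d + 1) * (A.filter fun σ => ∀ x ∈ seen σ j, σ (j + 1) < x).card) =
      A.card * (2 * (n - d)) := by
  have h1 := hA.mul_card_filter_next hj fun T k => ∀ x ∈ T, k < x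
  have h2 := hA.sum_seen_mul_choose hj.le hd
    fun T => ((Finset.Icc 1 n).filter fun k => ∀ x ∈ T, k < x).card
  rw [sum_powersetCard_card_lt] at h2
  rw [Finset.sum_congr rfl fun σ hσ => card_filter_lt_seen (hA.1 hσ), ← Finset.mul_sum] at h1
  set s := ∑ σ ∈ A, ((Finset.Icc 1 n).filter fun k => ∀ x ∈ seen σ j, k < x).card
  have h3 := Nat.choose_succ_right_eq n d
  have hpos : 0 < n.choose d := Nat.choose_pos hdn
  have h4 : s * (d + 1) = A.card * (n - d) := by
    refine Nat.eq_of_mul_eq_mul_right hpos ?_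
    calc s * (d + 1) * n.choose d = s * n.choose d * (d + 1) := by ring
      _ = A.card * (n.choose (d + 1) * (d + 1)) := by rw [h2]; ring
      _ = A.card * (n - d) * n.choose d := by rw [h3]; ring
  calc _ = (d + 1) * ((2 * n - j) *
        (A.filter fun σ => ∀ x ∈ seen σ j, σ (j + 1) < x).card) := by ring
    _ = 2 * (s * (d + 1)) := by rw [h1]; ring
    _ = _ := by rw [h4]; ring

theorem Saturated.mul_card_second (hA : Saturated n j A) (hj : j < 2 * n)
    (hS : ∀ σ ∈ A, bestCount σ j = 1) :
    (2 * n - j) * (A.filter fun σ => σ (j + 1) ∈ seen σ j ∧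
      ∀ x ∈ seen σ j, σ (j + 1) ≤ x).card = A.card := by
  rw [hA.mul_card_filter_next hj fun T k => k ∈ T ∧ ∀ x ∈ T, k ≤ x, Finset.card_eq_sum_ones]
  refine Finset.sum_congr rfl fun σ hσ => ?_
  have hj1 : 1 ≤ j := by
    by_contra h
    have := hS σ hσ
    rw [show j = 0 by omega, bestCount_zero] at this
    omega
  have h := card_filter_best_add_bestCount (hA.1 hσ) hj1 hj.le
  rw [hS σ hσ] at h
  omega

end Transition

/-! ### The value processes and the martingale property. -/

/-- The value of rejecting the `j`-th applicant. -/
noncomputable def rejectValue (n : ℕ) (σ : ℕ → ℕ) (j : ℕ) : ℝ :=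
  if bestCount σ j = 1 then openValue n (numDistinct σ j) else closedValue n (numDistinct σ j)

/-- The value of being offered the `j`-th applicant. -/
noncomputable def offerValue (n : ℕ) (σ : ℕ → ℕ) (j : ℕ) : ℝ :=
  if relRank σ j = 1 ∧ bestCount σ j = 2 then
    max ((numDistinct σ j : ℝ) / n) (closedValue n (numDistinct σ j))
  else rejectValue n σ j

/-- The conditional winning probability when the `j`-th applicant is accepted. -/
noncomputable def acceptValue (n : ℕ) (σ : ℕ → ℕ) (j : ℕ) : ℝ :=
  if relRank σ j = 1 then (numDistinct σ j : ℝ) / n else 0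

/-- The case `d = n` is included: the coefficient of the meaningless value at `n + 1` vanishes. -/
theorem openValue_balance {n d : ℕ} (hn : 1 ≤ n) (h : d ≤ n) :
    (2 * ((n : ℝ) - d) + 1) * openValue n d =
      max ((d : ℝ) / n) (closedValue n d) + 2 * ((n : ℝ) - d) * openValue n (d + 1) := by
  rcases h.lt_or_eq with h | rfl
  · exact openValue_rec h
  · have : (d : ℝ) ≠ 0 := by exact_mod_cast (by omega : d ≠ 0)
    simp [openValue_self, closedValue_self, this]

theorem closedValue_balance {n d : ℕ} (h : d ≤ n) :
    2 * ((n : ℝ) - d) * (((d : ℝ) + 1) * closedValue n d) =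
      2 * ((n : ℝ) - d) * (openValue n (d + 1) + d * closedValue n (d + 1)) := by
  rcases h.lt_or_eq with h | rfl
  · rw [closedValue_rec h]
  · simp

/-- From an open state the value changes only through a new rank, best or not, or through the second
copy of the current best. -/
theorem offerValue_succ_of_bestCount_eq_one {n j : ℕ} {σ : ℕ → ℕ} (hS : bestCount σ j = 1) :
    offerValue n σ (j + 1) = openValue n (numDistinct σ j) +
      (if σ (j + 1) ∉ seen σ j then
        openValue n (numDistinct σ j + 1) - openValue n (numDistinct σ j) else 0) +
      (if σ (j + 1) ∈ seen σ j ∧ ∀ x ∈ seen σ j, σ (j + 1) ≤ x then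
        max ((numDistinct σ j : ℝ) / n) (closedValue n (numDistinct σ j)) -
          openValue n (numDistinct σ j) else 0) := by
  unfold offerValue rejectValue
  simp only [relRank_succ_eq_one_iff, bestCount_succ, numDistinct_succ, hS]
  by_cases h1 : σ (j + 1) ∈ seen σ j <;> by_cases h2 : ∀ x ∈ seen σ j, σ (j + 1) ≤ x
  · simp only [h1, eq_true h2]
    simp
  · simp [h1, h2]
  · simp only [h1, eq_true h2]
    simp
  · simp [h1, h2]

theorem offerValue_succ_of_bestCount_ne_one {n j : ℕ} {σ : ℕ → ℕ} (hσ : σ ∈ orderings n)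
    (hj : j < 2 * n) (hS : bestCount σ j ≠ 1) :
    offerValue n σ (j + 1) = closedValue n (numDistinct σ j) +
      (if σ (j + 1) ∉ seen σ j then
        closedValue n (numDistinct σ j + 1) - closedValue n (numDistinct σ j) else 0) +
      (if ∀ x ∈ seen σ j, σ (j + 1) < x then
        openValue n (numDistinct σ j + 1) - closedValue n (numDistinct σ j + 1) else 0) := by
  have hle := bestCount_le_two hσ (j := j + 1) hj
  have hsucc := bestCount_succ σ j
  have hlt : (∀ x ∈ seen σ j, σ (j + 1) < x) ↔
      σ (j + 1) ∉ seen σ j ∧ ∀ x ∈ seen σ j, σ (j + 1) ≤ x :=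
    ⟨fun h => ⟨fun hm => lt_irrefl _ (h _ hm), fun x hx => (h x hx).le⟩,
      fun h x hx => lt_of_le_of_ne (h.2 x hx) fun he => h.1 (he ▸ hx)⟩
  unfold offerValue rejectValue
  simp only [hlt, relRank_succ_eq_one_iff, numDistinct_succ]
  by_cases h1 : σ (j + 1) ∈ seen σ j <;> by_cases h2 : ∀ x ∈ seen σ j, σ (j + 1) ≤ x
  -- The current best would occur a third time.
  · exfalso
    rw [if_pos h2, if_pos h1] at hsucc
    obtain ⟨i, hi, -⟩ := mem_seen.1 h1
    have := one_le_bestCount σ (hi.1.trans hi.2)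
    omega
  · rw [if_neg h2] at hsucc
    simp [h1, h2, hsucc, hS]
  · rw [if_pos h2, if_neg h1] at hsucc
    simp only [h1, eq_true h2, hsucc]
    simp
  · rw [if_neg h2] at hsucc
    simp [h1, h2, hsucc, hS]

/-- The value process is a martingale as long as applicants are rejected. -/
theorem Saturated.sum_offerValue_succ {n j : ℕ} {A : Finset (ℕ → ℕ)} (hA : Saturated n j A)
    (hj : j < 2 * n) : ∑ σ ∈ A, offerValue n σ (j + 1) = ∑ σ ∈ A, rejectValue n σ j := by
  let g : (ℕ → ℕ) → ℕ × ℕ := fun σ => (numDistinct σ j, bestCount σ j)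
  have hmaps : ∀ σ ∈ A, g σ ∈ A.image g := fun σ hσ => Finset.mem_image_of_mem g hσ
  rw [← Finset.sum_fiberwise_of_maps_to hmaps, ← Finset.sum_fiberwise_of_maps_to hmaps]
  refine Finset.sum_congr rfl fun p hp => ?_
  obtain ⟨σ₀, hσ₀, rfl⟩ := Finset.mem_image.1 hp
  have hdn : numDistinct σ₀ j ≤ n := numDistinct_le (hA.1 hσ₀) hj.le
  set d := numDistinct σ₀ j with hd_def
  set s := bestCount σ₀ j with hs_def
  -- The state `(D, S)` is determined by the observations, so its fibres are again saturated and the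
  -- transition counts apply to each.
  have hB : Saturated n j (A.filter fun σ => g σ = g σ₀) := hA.filter fun σ σ' h hg => by
    rw [← hg]
    simp only [g, (h j le_rfl).2, h.bestCount_eq]
  set B := A.filter fun σ => g σ = g σ₀
  have hBd : ∀ σ ∈ B, numDistinct σ j = d := fun σ hσ =>
    congrArg Prod.fst (Finset.mem_filter.1 hσ).2
  have hBs : ∀ σ ∈ B, bestCount σ j = s := fun σ hσ =>
    congrArg Prod.snd (Finset.mem_filter.1 hσ).2
  have hnj : ((2 * n - j : ℕ) : ℝ) = 2 * n - j := by
    rw [Nat.cast_sub hj.le]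
    push_cast
    rfl
  have hnd : ((n - d : ℕ) : ℝ) = n - d := Nat.cast_sub hdn
  have hpos : (0 : ℝ) < 2 * n - j := by
    rw [← hnj]
    exact_mod_cast (by omega : 0 < 2 * n - j)
  have hnew := congrArg (Nat.cast (R := ℝ)) (hB.mul_card_new hj hBd)
  push_cast [hnj, hnd] at hnew
  by_cases hs : s = 1
  · have hS : ∀ σ ∈ B, bestCount σ j = 1 := fun σ hσ => (hBs σ hσ).trans hs
    have hsec := congrArg (Nat.cast (R := ℝ)) (hB.mul_card_second hj hS)
    push_cast [hnj] at hsec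
    have h1 : ∀ σ ∈ B, offerValue n σ (j + 1) = openValue n d +
        (if σ (j + 1) ∉ seen σ j then openValue n (d + 1) - openValue n d else 0) +
        (if σ (j + 1) ∈ seen σ j ∧ ∀ x ∈ seen σ j, σ (j + 1) ≤ x then
          max ((d : ℝ) / n) (closedValue n d) - openValue n d else 0) := fun σ hσ => by
      rw [offerValue_succ_of_bestCount_eq_one (hS σ hσ), hBd σ hσ]
    have h2 : ∀ σ ∈ B, rejectValue n σ j = openValue n d := fun σ hσ => by
      rw [rejectValue, if_pos (hS σ hσ), hBd σ hσ]
    have hbal := openValue_balance (by omega : 1 ≤ n) hdn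
    rw [Finset.sum_congr rfl h1, Finset.sum_congr rfl h2, Finset.sum_add_distrib,
      Finset.sum_add_distrib, ← Finset.sum_filter, ← Finset.sum_filter, Finset.sum_const,
      Finset.sum_const, Finset.sum_const, nsmul_eq_mul, nsmul_eq_mul, nsmul_eq_mul]
    -- After multiplication by `2n - j`, the transition counts reduce the claim to the recursion for
    -- W times the size of the fibre.
    refine mul_left_cancel₀ hpos.ne' ?_
    linear_combination (openValue n (d + 1) - openValue n d) * hnew +
      (max ((d : ℝ) / n) (closedValue n d) - openValue n d) * hsec - (B.card : ℝ) * hbal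
  · have hS : ∀ σ ∈ B, bestCount σ j ≠ 1 := fun σ hσ => by rwa [hBs σ hσ]
    have hbest := congrArg (Nat.cast (R := ℝ)) (hB.mul_card_newBest hj hBd hdn)
    push_cast [hnj, hnd] at hbest
    have h1 : ∀ σ ∈ B, offerValue n σ (j + 1) = closedValue n d +
        (if σ (j + 1) ∉ seen σ j then closedValue n (d + 1) - closedValue n d else 0) +
        (if ∀ x ∈ seen σ j, σ (j + 1) < x then
          openValue n (d + 1) - closedValue n (d + 1) else 0) := fun σ hσ => by
      rw [offerValue_succ_of_bestCount_ne_one (hB.1 hσ) hj (hS σ hσ), hBd σ hσ]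
    have h2 : ∀ σ ∈ B, rejectValue n σ j = closedValue n d := fun σ hσ => by
      rw [rejectValue, if_neg (hS σ hσ), hBd σ hσ]
    have hbal := closedValue_balance hdn
    rw [Finset.sum_congr rfl h1, Finset.sum_congr rfl h2, Finset.sum_add_distrib,
      Finset.sum_add_distrib, ← Finset.sum_filter, ← Finset.sum_filter, Finset.sum_const,
      Finset.sum_const, Finset.sum_const, nsmul_eq_mul, nsmul_eq_mul, nsmul_eq_mul]
    have hd1 : (d : ℝ) + 1 ≠ 0 := by positivity
    refine mul_left_cancel₀ hpos.ne' (mul_left_cancel₀ hd1 ?_)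
    linear_combination ((d : ℝ) + 1) * (closedValue n (d + 1) - closedValue n d) * hnew +
      (openValue n (d + 1) - closedValue n (d + 1)) * hbest - (B.card : ℝ) * hbal

theorem eq_one_iff_one_mem_seen {n j : ℕ} {σ : ℕ → ℕ} (hσ : σ ∈ orderings n) (hj : 1 ≤ j)
    (hjn : j ≤ 2 * n) (hX : relRank σ j = 1) : σ j = 1 ↔ 1 ∈ seen σ j := by
  have hm : σ j ∈ seen σ j := mem_seen.2 ⟨j, ⟨hj, le_rfl⟩, rfl⟩
  refine ⟨fun h => h ▸ hm, fun h => ?_⟩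
  have h1 := (relRank_eq_one_iff σ hj).1 hX 1 h
  have h2 := Finset.mem_Icc.1 (seen_subset hσ hjn hm)
  omega

theorem relRank_eq_one_of_eq_one {n j : ℕ} {σ : ℕ → ℕ} (hσ : σ ∈ orderings n) (hj : 1 ≤ j)
    (hjn : j ≤ 2 * n) (h : σ j = 1) : relRank σ j = 1 := by
  rw [relRank_eq_one_iff σ hj, h]
  exact fun x hx => (Finset.mem_Icc.1 (seen_subset hσ hjn hx)).1

/-- When `X = 1`, the applicant is best exactly if rank 1 has been seen, and a uniform `d`-subset
contains 1 with probability `d/n`. When `X ≠ 1`, the applicant cannot have rank 1. -/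
theorem Saturated.sum_acceptValue {n j : ℕ} {A : Finset (ℕ → ℕ)} (hA : Saturated n j A)
    (hj : 1 ≤ j) (hjn : j ≤ 2 * n) :
    ∑ σ ∈ A, acceptValue n σ j = ((A.filter fun σ => σ j = 1).card : ℝ) := by
  let g : (ℕ → ℕ) → ℕ × ℕ := fun σ => (numDistinct σ j, relRank σ j)
  have hmaps : ∀ σ ∈ A, g σ ∈ A.image g := fun σ hσ => Finset.mem_image_of_mem g hσ
  rw [Finset.card_filter, Nat.cast_sum, ← Finset.sum_fiberwise_of_maps_to hmaps,
    ← Finset.sum_fiberwise_of_maps_to hmaps]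
  refine Finset.sum_congr rfl fun p hp => ?_
  obtain ⟨σ₀, hσ₀, rfl⟩ := Finset.mem_image.1 hp
  have hdn : numDistinct σ₀ j ≤ n := numDistinct_le (hA.1 hσ₀) hjn
  set d := numDistinct σ₀ j with hd_def
  have hB : Saturated n j (A.filter fun σ => g σ = g σ₀) := hA.filter fun σ σ' h hg => by
    rw [← hg]
    simp only [g, (h j le_rfl).2, (h j le_rfl).1]
  set B := A.filter fun σ => g σ = g σ₀
  have hBd : ∀ σ ∈ B, numDistinct σ j = d := fun σ hσ =>
    congrArg Prod.fst (Finset.mem_filter.1 hσ).2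
  have hBx : ∀ σ ∈ B, relRank σ j = relRank σ₀ j := fun σ hσ =>
    congrArg Prod.snd (Finset.mem_filter.1 hσ).2
  have hn : (n : ℝ) ≠ 0 := by exact_mod_cast (by omega : n ≠ 0)
  by_cases hX : relRank σ₀ j = 1
  · have h1 : ∀ σ ∈ B, acceptValue n σ j = (d : ℝ) / n := fun σ hσ => by
      rw [acceptValue, if_pos ((hBx σ hσ).trans hX), hBd σ hσ]
    have h2 : ∀ σ ∈ B, (if σ j = 1 then 1 else 0 : ℕ) = if 1 ∈ seen σ j then 1 else 0 :=
      fun σ hσ => by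
        simp only [eq_one_iff_one_mem_seen (hB.1 hσ) hj hjn ((hBx σ hσ).trans hX)]
    have h3 := hB.sum_seen_mul_choose hjn hBd fun T => if 1 ∈ T then 1 else 0
    rw [← Finset.card_filter (p := fun T => 1 ∈ T)] at h3
    have h4 := mul_card_powersetCard_one_mem (by omega : 1 ≤ n) d
    have hpos : (n.choose d : ℝ) ≠ 0 := by exact_mod_cast (Nat.choose_pos hdn).ne'
    rw [Finset.sum_congr rfl h1, ← Nat.cast_sum, Finset.sum_congr rfl h2, Finset.sum_const,
      nsmul_eq_mul]
    have h3' := congrArg (Nat.cast (R := ℝ)) h3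
    have h4' := congrArg (Nat.cast (R := ℝ)) h4
    rw [Nat.cast_mul, Nat.cast_mul] at h3' h4'
    refine mul_left_cancel₀ hn (mul_right_cancel₀ hpos ?_)
    have h5 : (n : ℝ) * ((B.card : ℝ) * (d / n)) = B.card * d := by field_simp
    rw [h5]
    linear_combination (-(n : ℝ)) * h3' - (B.card : ℝ) * h4'
  · have h1 : ∀ σ ∈ B, acceptValue n σ j = 0 := fun σ hσ => by
      rw [acceptValue, if_neg (by rwa [hBx σ hσ])]
    have h2 : ∀ σ ∈ B, ((if σ j = 1 then 1 else 0 : ℕ) : ℝ) = 0 := fun σ hσ => by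
      rw [if_neg fun h => hX ?_, Nat.cast_zero]
      rw [← hBx σ hσ]
      exact relRank_eq_one_of_eq_one (hB.1 hσ) hj hjn h
    rw [Finset.sum_congr rfl h1, Finset.sum_congr rfl h2]

theorem rejectValue_le_offerValue {n j : ℕ} (σ : ℕ → ℕ) :
    rejectValue n σ j ≤ offerValue n σ j := by
  unfold offerValue
  split_ifs with h
  · rw [rejectValue, if_neg (by omega)]
    exact le_max_right _ _
  · exact le_rfl

/-- For a first copy of the best rank this is `d/n ≤ W(d)`; for a second copy it is one side of the
maximum; otherwise accepting is worth 0. -/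
theorem acceptValue_le_offerValue {n j : ℕ} {σ : ℕ → ℕ} (hσ : σ ∈ orderings n) (hj : 1 ≤ j)
    (hjn : j ≤ 2 * n) : acceptValue n σ j ≤ offerValue n σ j := by
  have hd := one_le_numDistinct σ hj
  have hdn := numDistinct_le hσ hjn
  have hS := bestCount_le_two hσ hjn
  have hS' := one_le_bestCount σ hj
  have hW := div_le_openValue hd hdn
  have hV := closedValue_nonneg hd hdn
  have h0 : (0 : ℝ) ≤ (numDistinct σ j : ℝ) / n := by positivity
  unfold acceptValue offerValue rejectValue
  by_cases hX : relRank σ j = 1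
  · by_cases h1 : bestCount σ j = 1
    · simp [hX, h1, hW]
    · have h2 : bestCount σ j = 2 := by omega
      simp [hX, h2]
  · simp only [hX, if_false, false_and]
    split_ifs
    · linarith
    · exact hV

/-! ### Rules on orderings, the optimal bound and its attainment. -/

/-- A rule for orderings, with values in `{1, …, 2n}`, for which the decision to go on after `j`
applicants is determined by the observations up to time `j`. -/
structure IsRule (n : ℕ) (τ : (ℕ → ℕ) → ℕ) : Prop where
  mem_Icc : ∀ σ ∈ orderings n, τ σ ∈ Finset.Icc 1 (2 * n)
  saturated : ∀ j, Saturated n j ((orderings n).filter fun σ => j < τ σ)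

/-- The number of orderings for which the rule selects a best applicant. -/
def wins (n : ℕ) (τ : (ℕ → ℕ) → ℕ) : ℕ := ((orderings n).filter fun σ => σ (τ σ) = 1).card

namespace IsRule

variable {n : ℕ} {τ : (ℕ → ℕ) → ℕ}

theorem saturated_eq (hτ : IsRule n τ) {j : ℕ} (hj : 1 ≤ j) :
    Saturated n j ((orderings n).filter fun σ => τ σ = j) := by
  refine ⟨Finset.filter_subset _ _, fun σ hσ σ' hσ' h => ?_⟩
  rw [Finset.mem_filter] at hσ ⊢
  refine ⟨hσ', ?_⟩
  have h1 := (hτ.saturated (j - 1)).2 σ (Finset.mem_filter.2 ⟨hσ.1, by omega⟩) σ' hσ'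
    (h.mono (Nat.sub_le j 1))
  rw [Finset.mem_filter] at h1
  have h2 : ¬ j < τ σ' := fun hlt => by
    have h3 := (hτ.saturated j).2 σ' (Finset.mem_filter.2 ⟨hσ', hlt⟩) σ hσ.1 h.symm
    rw [Finset.mem_filter] at h3
    omega
  omega

theorem wins_eq (hτ : IsRule n τ) :
    (wins n τ : ℝ) = ∑ σ ∈ orderings n, acceptValue n σ (τ σ) := by
  rw [wins, Finset.card_filter, Nat.cast_sum, ← Finset.sum_fiberwise_of_maps_to hτ.mem_Icc,
    ← Finset.sum_fiberwise_of_maps_to hτ.mem_Icc]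
  refine Finset.sum_congr rfl fun j hj => ?_
  rw [Finset.mem_Icc] at hj
  have h := (hτ.saturated_eq hj.1).sum_acceptValue hj.1 hj.2
  rw [Finset.card_filter, Nat.cast_sum] at h
  refine Eq.trans ?_ (h.symm.trans ?_)
  · refine Finset.sum_congr rfl fun σ hσ => ?_
    rw [(Finset.mem_filter.1 hσ).2]
  · refine Finset.sum_congr rfl fun σ hσ => ?_
    rw [(Finset.mem_filter.1 hσ).2]

/-- Optional stopping: the increment from `j` to `j + 1` is counted on `{j < τ}`, which is
determined by the observations up to `j`, and sums to zero there. -/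
theorem sum_increments (hτ : IsRule n τ) :
    ∑ σ ∈ orderings n, ∑ j ∈ Finset.range (τ σ),
      (offerValue n σ (j + 1) - rejectValue n σ j) = 0 := by
  have h1 : ∀ σ ∈ orderings n, ∑ j ∈ Finset.range (τ σ),
      (offerValue n σ (j + 1) - rejectValue n σ j) = ∑ j ∈ Finset.range (2 * n),
        if j < τ σ then offerValue n σ (j + 1) - rejectValue n σ j else 0 := fun σ hσ => by
    have := Finset.mem_Icc.1 (hτ.mem_Icc σ hσ)
    rw [← Finset.sum_filter]
    congr 1
    ext j
    simp only [Finset.mem_range, Finset.mem_filter]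
    omega
  rw [Finset.sum_congr rfl h1, Finset.sum_comm]
  refine Finset.sum_eq_zero fun j hj => ?_
  rw [← Finset.sum_filter, Finset.sum_sub_distrib,
    (hτ.saturated j).sum_offerValue_succ (Finset.mem_range.1 hj), sub_self]

end IsRule

/-- A shift of index isolates the losses `offerValue - rejectValue` from passing over applicants.
Before the first interview `S = 0`, so the initial state counts as closed with `d = 0`. -/
theorem sum_range_increments {n : ℕ} (σ : ℕ → ℕ) {t : ℕ} (ht : 1 ≤ t) :
    ∑ j ∈ Finset.range t, (offerValue n σ (j + 1) - rejectValue n σ j) =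
      offerValue n σ t - closedValue n 0 +
        ∑ j ∈ Finset.range (t - 1), (offerValue n σ (j + 1) - rejectValue n σ (j + 1)) := by
  obtain ⟨s, rfl⟩ := Nat.exists_eq_add_of_le' ht
  have h0 : rejectValue n σ 0 = closedValue n 0 := by
    simp [rejectValue, bestCount_zero, numDistinct_zero]
  rw [Nat.add_sub_cancel, Finset.sum_sub_distrib, Finset.sum_range_succ,
    Finset.sum_range_succ' (fun j => rejectValue n σ j), h0, Finset.sum_sub_distrib]
  ring

theorem IsRule.wins_le {n : ℕ} {τ : (ℕ → ℕ) → ℕ} (hτ : IsRule n τ) :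
    (wins n τ : ℝ) ≤ (orderings n).card * closedValue n 0 := by
  have h : ∑ σ ∈ orderings n, (acceptValue n σ (τ σ) - closedValue n 0) ≤ 0 := by
    rw [← hτ.sum_increments]
    refine Finset.sum_le_sum fun σ hσ => ?_
    have ht := Finset.mem_Icc.1 (hτ.mem_Icc σ hσ)
    rw [sum_range_increments σ ht.1]
    have h1 := acceptValue_le_offerValue hσ ht.1 ht.2
    have h2 : 0 ≤ ∑ j ∈ Finset.range (τ σ - 1),
        (offerValue n σ (j + 1) - rejectValue n σ (j + 1)) :=
      Finset.sum_nonneg fun j _ => sub_nonneg.2 (rejectValue_le_offerValue σ)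
    linarith
  rw [Finset.sum_sub_distrib, ← hτ.wins_eq, Finset.sum_const, nsmul_eq_mul] at h
  linarith

/-- The stopping condition of the threshold rule. -/
def IsCandidate (n : ℕ) (σ : ℕ → ℕ) (j : ℕ) : Prop :=
  relRank σ j = 1 ∧ bestCount σ j = 2 ∧ threshold n ≤ numDistinct σ j

theorem offerValue_eq_rejectValue {n j : ℕ} {σ : ℕ → ℕ} (hσ : σ ∈ orderings n) (hj : 1 ≤ j)
    (hjn : j ≤ 2 * n) (h : ¬ IsCandidate n σ j) : offerValue n σ j = rejectValue n σ j := by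
  unfold offerValue
  split_ifs with h1
  · have hthr : ¬ threshold n ≤ numDistinct σ j := fun h2 => h ⟨h1.1, h1.2, h2⟩
    rw [rejectValue, if_neg (by omega), max_eq_right
      (div_le_closedValue (one_le_numDistinct σ hj) (numDistinct_le hσ hjn) hthr)]
  · rfl

theorem acceptValue_eq_offerValue {n j : ℕ} {σ : ℕ → ℕ} (hσ : σ ∈ orderings n) (hj : 1 ≤ j)
    (hjn : j ≤ 2 * n) (h : IsCandidate n σ j) : acceptValue n σ j = offerValue n σ j := by
  rw [acceptValue, offerValue, if_pos h.1, if_pos ⟨h.1, h.2.1⟩, max_eq_left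
    (closedValue_le_div (one_le_numDistinct σ hj) (numDistinct_le hσ hjn) h.2.2)]

/-- At time `2n` one has `D = n`, `S = 2` and `V(n) = 0`, so being forced to take the last applicant
costs nothing. -/
theorem acceptValue_last {n : ℕ} {σ : ℕ → ℕ} (hσ : σ ∈ orderings n) (hn : 1 ≤ n) :
    acceptValue n σ (2 * n) = offerValue n σ (2 * n) := by
  have hD : numDistinct σ (2 * n) = n := by
    have h := card_filter_notMem_seen hσ le_rfl
    have := numDistinct_le hσ le_rfl
    simp at h
    omega
  have hS : bestCount σ (2 * n) = 2 := by
    have h := card_filter_best_add_bestCount hσ (by omega) le_rfl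
    simpa using h
  simp only [acceptValue, offerValue, rejectValue, hD, hS, closedValue_self]
  have : (0 : ℝ) ≤ (n : ℝ) / n := by positivity
  simp [this]

theorem IsRule.wins_eq_of_threshold {n : ℕ} {τ : (ℕ → ℕ) → ℕ} (hn : 1 ≤ n) (hτ : IsRule n τ)
    (hlt : ∀ σ ∈ orderings n, ∀ j, 1 ≤ j → j < τ σ → ¬ IsCandidate n σ j)
    (heq : ∀ σ ∈ orderings n, IsCandidate n σ (τ σ) ∨ τ σ = 2 * n) :
    (wins n τ : ℝ) = (orderings n).card * closedValue n 0 := by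
  have h : ∑ σ ∈ orderings n, (acceptValue n σ (τ σ) - closedValue n 0) = 0 := by
    rw [← hτ.sum_increments]
    refine Finset.sum_congr rfl fun σ hσ => ?_
    have ht := Finset.mem_Icc.1 (hτ.mem_Icc σ hσ)
    rw [sum_range_increments σ ht.1]
    have h1 : acceptValue n σ (τ σ) = offerValue n σ (τ σ) := by
      rcases heq σ hσ with h | h
      · exact acceptValue_eq_offerValue hσ ht.1 ht.2 h
      · rw [h, acceptValue_last hσ hn]
    have h2 : ∑ j ∈ Finset.range (τ σ - 1),
        (offerValue n σ (j + 1) - rejectValue n σ (j + 1)) = 0 :=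
      Finset.sum_eq_zero fun j hj => by
        rw [Finset.mem_range] at hj
        rw [offerValue_eq_rejectValue hσ (by omega) (by omega)
          (hlt σ hσ (j + 1) (by omega) (by omega)), sub_self]
    rw [h1, h2, add_zero]
  rw [Finset.sum_sub_distrib, ← hτ.wins_eq, Finset.sum_const, nsmul_eq_mul] at h
  linarith

/-! ### Transfer between the probability space and the orderings. -/

/-- The sequence `r 1, …, r (2n)`, continued by zeros. -/
def trim (n : ℕ) (r : ℕ → ℕ) (j : ℕ) : ℕ := if j ∈ Finset.Icc 1 (2 * n) then r j else 0

theorem trim_apply {n j : ℕ} (r : ℕ → ℕ) (hj : j ∈ Finset.Icc 1 (2 * n)) : trim n r j = r j :=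
  if_pos hj

theorem trim_eq_iff {n : ℕ} {r σ : ℕ → ℕ} (hσ : σ ∈ orderings n) :
    trim n r = σ ↔ ∀ j ∈ Finset.Icc 1 (2 * n), r j = σ j := by
  constructor
  · rintro rfl j hj
    exact (trim_apply r hj).symm
  · intro h
    funext j
    by_cases hj : j ∈ Finset.Icc 1 (2 * n)
    · rw [trim_apply r hj, h j hj]
    · rw [trim, if_neg hj, (mem_orderings.1 hσ).2 j hj]

theorem sameObs_trim {n j : ℕ} (r : ℕ → ℕ) (hj : j ≤ 2 * n) : SameObs j (trim n r) r :=
  sameObs_of_eqOn fun _ hi => trim_apply r (Finset.Icc_subset_Icc_right hj hi)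

section Law

variable {Ω : Type*} [MeasurableSpace Ω] {P : Measure Ω} [IsProbabilityMeasure P] {n : ℕ}
  {R : ℕ → Ω → ℕ}

theorem real_trim_mem (hR : ∀ j, Measurable (R j))
    (hlaw : ∀ σ : ℕ → ℕ, IsOrdering n σ →
      P.real {ω | ∀ j ∈ Finset.Icc 1 (2 * n), R j ω = σ j}
        = (2 : ℝ) ^ n / ((2 * n).factorial : ℝ))
    {S : Finset (ℕ → ℕ)} (hS : S ⊆ orderings n) :
    P.real {ω | trim n (fun j => R j ω) ∈ S} =
      S.card * ((2 : ℝ) ^ n / ((2 * n).factorial : ℝ)) := by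
  have h1 : {ω | trim n (fun j => R j ω) ∈ S} =
      ⋃ σ ∈ S, {ω | trim n (fun j => R j ω) = σ} := by
    ext ω
    simp
  have h2 : ∀ σ ∈ S, {ω | trim n (fun j => R j ω) = σ} =
      {ω | ∀ j ∈ Finset.Icc 1 (2 * n), R j ω = σ j} := fun σ hσ => by
    ext ω
    exact trim_eq_iff (hS hσ)
  rw [h1, measureReal_biUnion_finset]
  · rw [← nsmul_eq_mul, ← Finset.sum_const]
    refine Finset.sum_congr rfl fun σ hσ => ?_
    rw [h2 σ hσ, hlaw σ (mem_orderings.1 (hS hσ)).1]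
  · intro σ _ σ' _ hne
    refine Set.disjoint_left.2 fun ω h h' => hne ?_
    exact Eq.trans (Eq.symm h) h'
  · intro σ hσ
    rw [h2 σ hσ]
    have : {ω | ∀ j ∈ Finset.Icc 1 (2 * n), R j ω = σ j} =
        ⋂ j ∈ Finset.Icc 1 (2 * n), R j ⁻¹' {σ j} := by
      ext ω
      simp
    rw [this]
    exact Finset.measurableSet_biInter _ fun j _ => hR j (measurableSet_singleton _)

theorem ae_trim_mem (hR : ∀ j, Measurable (R j))
    (hlaw : ∀ σ : ℕ → ℕ, IsOrdering n σ →
      P.real {ω | ∀ j ∈ Finset.Icc 1 (2 * n), R j ω = σ j}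
        = (2 : ℝ) ^ n / ((2 * n).factorial : ℝ)) :
    ∀ᵐ ω ∂P, trim n (fun j => R j ω) ∈ orderings n := by
  have h := real_trim_mem hR hlaw (Finset.Subset.refl (orderings n))
  have hc := congrArg (Nat.cast (R := ℝ)) (card_orderings n)
  push_cast at hc
  -- The masses of the orderings already add up to 1.
  rw [← mul_div_assoc, hc, div_self (by exact_mod_cast (Nat.factorial_pos _).ne')] at h
  have hm : MeasurableSet {ω | trim n (fun j => R j ω) ∈ orderings n} := by
    have hmeas : Measurable fun ω => trim n fun j => R j ω := by
      refine measurable_pi_lambda _ fun j => ?_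
      by_cases hj : j ∈ Finset.Icc 1 (2 * n)
      · simpa only [trim, if_pos hj] using hR j
      · simpa only [trim, if_neg hj] using measurable_const
    exact hmeas (orderings n).measurableSet
  change {ω | trim n (fun j => R j ω) ∈ orderings n} ∈ ae P
  rw [mem_ae_iff_prob_eq_one hm]
  rwa [measureReal_def, ENNReal.toReal_eq_one_iff] at h

/-- The event `{τ ≤ j}` is a preimage under the vector of observations up to `j`, so outcomes with
equal observations cannot be separated by it. -/
theorem stoppingRule_le_iff (hR : ∀ j, Measurable (R j)) {τ : Ω → ℕ}
    (hτ : τ ∈ stoppingRules n R hR) {j : ℕ} {ω ω' : Ω}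
    (h : SameObs j (fun k => R k ω) (fun k => R k ω')) : τ ω ≤ j ↔ τ ω' ≤ j := by
  have hm := hτ.2.measurableSet_le j
  rw [obsFiltration, Filtration.natural_eq_comap] at hm
  obtain ⟨B, -, hB⟩ := hm
  have hmem : ∀ ω, τ ω ≤ j ↔ (fun i : Set.Iic j => obs R i ω) ∈ B := fun ω => by
    have h1 : ω ∈ (fun ω (i : Set.Iic j) => obs R i ω) ⁻¹' B ↔ (τ ω : WithTop ℕ) ≤ j := by
      rw [hB]
      rfl
    rw [← WithTop.coe_le_coe]
    exact h1.symm
  have hobs : (fun i : Set.Iic j => obs R i ω) = fun i : Set.Iic j => obs R i ω' := by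
    funext i
    exact Prod.ext (h i i.2).1 (h i i.2).2
  rw [hmem, hmem, hobs]

/-- Every admissible stopping rule induces a rule on the orderings. -/
theorem exists_isRule (hR : ∀ j, Measurable (R j))
    (hlaw : ∀ σ : ℕ → ℕ, IsOrdering n σ →
      P.real {ω | ∀ j ∈ Finset.Icc 1 (2 * n), R j ω = σ j}
        = (2 : ℝ) ^ n / ((2 * n).factorial : ℝ))
    {τ : Ω → ℕ} (hτ : τ ∈ stoppingRules n R hR) :
    ∃ τ' : (ℕ → ℕ) → ℕ, IsRule n τ' ∧
      (∀ σ ∈ orderings n, ∃ ω, trim n (fun j => R j ω) = σ ∧ τ' σ = τ ω) ∧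
      winProb P R τ = wins n τ' * ((2 : ℝ) ^ n / ((2 * n).factorial : ℝ)) := by
  -- Each ordering has positive probability, hence is realised by some outcome; the induced rule
  -- evaluates `τ` at a chosen one.
  have hex : ∀ σ ∈ orderings n, ∃ ω, trim n (fun j => R j ω) = σ := fun σ hσ => by
    have h := real_trim_mem hR hlaw (Finset.singleton_subset_iff.2 hσ)
    have hpos : (0 : ℝ) < ((Finset.card {σ} : ℕ) : ℝ) *
        ((2 : ℝ) ^ n / ((2 * n).factorial : ℝ)) := by
      have := Nat.factorial_pos (2 * n)
      rw [Finset.card_singleton]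
      positivity
    rw [← h] at hpos
    obtain ⟨ω, hω⟩ := nonempty_of_measureReal_ne_zero hpos.ne'
    exact ⟨ω, by simpa using hω⟩
  have : Nonempty Ω := nonempty_of_isProbabilityMeasure P
  choose! ρ hρ using hex
  have hτn : ∀ ω, 1 ≤ τ ω ∧ τ ω ≤ 2 * n := fun ω => Finset.mem_Icc.1 (hτ.1 ω)
  have hle : ∀ j ≤ 2 * n, ∀ ω ω', SameObs j (trim n fun k => R k ω) (trim n fun k => R k ω') →
      (τ ω ≤ j ↔ τ ω' ≤ j) := fun j hj ω ω' h =>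
    stoppingRule_le_iff hR hτ fun i hi => by
      have h1 := sameObs_trim (fun k => R k ω) hj i hi
      have h2 := sameObs_trim (fun k => R k ω') hj i hi
      exact ⟨h1.1.symm.trans ((h i hi).1.trans h2.1), h1.2.symm.trans ((h i hi).2.trans h2.2)⟩
  refine ⟨fun σ => τ (ρ σ), ⟨fun σ _ => hτ.1 _, fun j => ⟨Finset.filter_subset _ _, ?_⟩⟩,
    fun σ hσ => ⟨ρ σ, hρ σ hσ, rfl⟩, ?_⟩
  · intro σ hσ σ' hσ' h
    rw [Finset.mem_filter] at hσ ⊢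
    refine ⟨hσ', ?_⟩
    have hj : j ≤ 2 * n := by
      have := (hτn (ρ σ)).2
      omega
    have h1 := hle j hj (ρ σ) (ρ σ') (by rwa [hρ σ hσ.1, hρ σ' hσ'])
    omega
  · have heq : ∀ ω, trim n (fun j => R j ω) ∈ orderings n →
        (R (τ ω) ω = 1 ↔ trim n (fun j => R j ω) (τ (ρ (trim n fun j => R j ω))) = 1) := by
      intro ω hω
      -- The chosen representative may differ from `ω`, but it has the same ordering, hence the same
      -- observations and the same `τ`.
      have hsame : ∀ j, SameObs j (trim n fun k => R k ω)
          (trim n fun k => R k (ρ (trim n fun j => R j ω))) := fun j => by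
        rw [hρ _ hω]
        exact fun i _ => ⟨rfl, rfl⟩
      have h1 : τ (ρ (trim n fun j => R j ω)) = τ ω :=
        le_antisymm ((hle _ (hτn _).2 _ _ (hsame _)).1 le_rfl)
          ((hle _ (hτn _).2 _ _ (hsame _)).2 le_rfl)
      rw [h1, trim_apply _ (hτ.1 ω)]
    rw [wins, ← real_trim_mem hR hlaw (Finset.filter_subset _ _)]
    refine measureReal_congr ?_
    filter_upwards [ae_trim_mem hR hlaw] with ω hω
    refine propext ?_
    change R (τ ω) ω = 1 ↔ trim n (fun j => R j ω) ∈ Finset.filter _ _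
    rw [heq ω hω, Finset.mem_filter, and_iff_right hω]

end Law

/-! ### Admissibility and hitting properties of the threshold rule. -/

theorem measurable_obs_obsFiltration {Ω : Type*} [MeasurableSpace Ω] {R : ℕ → Ω → ℕ}
    (hR : ∀ j, Measurable (R j)) {i j : ℕ} (hij : i ≤ j) :
    Measurable[obsFiltration R hR j] (obs R i) :=
  (comap_measurable (obs R i)).mono
    (le_iSup₂ (f := fun k (_ : k ≤ j) => MeasurableSpace.comap (obs R k) inferInstance) i hij)
    le_rfl

theorem measurable_bestCount_obsFiltration {Ω : Type*} [MeasurableSpace Ω] {R : ℕ → Ω → ℕ}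
    (hR : ∀ j, Measurable (R j)) (j : ℕ) :
    Measurable[obsFiltration R hR j] fun ω => bestCount (fun k => R k ω) j := by
  induction j with
  | zero => simpa only [bestCount_zero] using measurable_const
  | succ j ih =>
    have ih' := ih.mono ((obsFiltration R hR).mono (Nat.le_succ j)) le_rfl
    have h1 := measurable_obs_obsFiltration hR (le_refl (j + 1))
    have h2 := measurable_obs_obsFiltration hR (Nat.le_succ j)
    simp only [bestCount_succ_eq_ite]
    have hX : MeasurableSet[obsFiltration R hR (j + 1)]
        {ω | relRank (fun k => R k ω) (j + 1) = 1} :=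
      h1.fst (measurableSet_singleton 1)
    have hD : MeasurableSet[obsFiltration R hR (j + 1)]
        {ω | numDistinct (fun k => R k ω) (j + 1) = numDistinct (fun k => R k ω) j} :=
      measurableSet_eq_fun h1.snd h2.snd
    exact Measurable.ite hX (Measurable.ite hD (ih'.add_const 1) measurable_const) ih'

theorem thresholdRule_mem_stoppingRules {Ω : Type*} [MeasurableSpace Ω] {n : ℕ} (hn : 1 ≤ n)
    {R : ℕ → Ω → ℕ} (hR : ∀ j, Measurable (R j)) :
    thresholdRule n R ∈ stoppingRules n R hR := by
  refine ⟨fun ω => Finset.mem_Icc.2 (hittingBtwn_mem_Icc (by omega) ω), ?_⟩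
  refine Adapted.isStoppingTime_hittingBtwn (fun j => ?_) (MeasurableSet.of_discrete)
  have h := measurable_obs_obsFiltration hR (le_refl j)
  exact h.fst.prodMk ((measurable_bestCount_obsFiltration hR j).prodMk h.snd)

theorem isCandidate_trim_iff {n j : ℕ} (r : ℕ → ℕ) (hj : j ≤ 2 * n) :
    IsCandidate n (trim n r) j ↔ IsCandidate n r j := by
  have h := sameObs_trim r hj
  rw [IsCandidate, IsCandidate, (h j le_rfl).1, (h j le_rfl).2, h.bestCount_eq]

theorem not_isCandidate_of_lt_thresholdRule {Ω : Type*} {n j : ℕ} {R : ℕ → Ω → ℕ} {ω : Ω}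
    (hj : 1 ≤ j) (hlt : j < thresholdRule n R ω) : ¬ IsCandidate n (fun k => R k ω) j := by
  unfold thresholdRule at hlt
  have h := notMem_of_lt_hittingBtwn hlt hj
  exact h

theorem isCandidate_thresholdRule {Ω : Type*} {n : ℕ} {R : ℕ → Ω → ℕ} {ω : Ω}
    (h : thresholdRule n R ω < 2 * n) :
    IsCandidate n (fun k => R k ω) (thresholdRule n R ω) :=
  hittingBtwn_mem_set_of_hittingBtwn_lt h

end DoubleSecretary

theorem theorem2p1 {Ω : Type*} [MeasurableSpace Ω] (P : Measure Ω) [IsProbabilityMeasure P]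
    (n : ℕ) (hn : 1 ≤ n) (R : ℕ → Ω → ℕ) (hR : ∀ j, Measurable (R j))
    (hlaw : ∀ σ : ℕ → ℕ, DoubleSecretary.IsOrdering n σ →
      P.real {ω | ∀ j ∈ Finset.Icc 1 (2 * n), R j ω = σ j}
        = (2 : ℝ) ^ n / ((2 * n).factorial : ℝ)) :
    DoubleSecretary.thresholdRule n R ∈ DoubleSecretary.stoppingRules n R hR ∧
      IsLUB (DoubleSecretary.winProb P R '' DoubleSecretary.stoppingRules n R hR)
        (DoubleSecretary.winProb P R (DoubleSecretary.thresholdRule n R)) := by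
  open DoubleSecretary in
  have hmem := thresholdRule_mem_stoppingRules hn hR
  refine ⟨hmem, IsGreatest.isLUB ⟨Set.mem_image_of_mem _ hmem, ?_⟩⟩
  rintro _ ⟨τ, hτ, rfl⟩
  obtain ⟨τ', h1, -, h2⟩ := exists_isRule hR hlaw hτ
  obtain ⟨θ, h3, hθ, h4⟩ := exists_isRule hR hlaw hmem
  -- Each ordering is the path of an outcome at which `θ` agrees with the threshold rule, so the
  -- hitting properties carry over to `θ`.
  have hopt : (wins n θ : ℝ) = (orderings n).card * closedValue n 0 := by
    refine h3.wins_eq_of_threshold hn (fun σ hσ j hj hlt => ?_) fun σ hσ => ?_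
    · obtain ⟨ω, rfl, hω⟩ := hθ σ hσ
      have hle := Finset.mem_Icc.1 (h3.mem_Icc _ hσ)
      rw [isCandidate_trim_iff _ (by omega)]
      exact not_isCandidate_of_lt_thresholdRule hj (hω ▸ hlt)
    · obtain ⟨ω, rfl, hω⟩ := hθ σ hσ
      have hle := Finset.mem_Icc.1 (h3.mem_Icc _ hσ)
      rw [isCandidate_trim_iff _ hle.2]
      rcases hle.2.lt_or_eq with hlt | heq
      · left
        rw [hω] at hlt ⊢
        exact isCandidate_thresholdRule hlt
      · exact Or.inr heq
  rw [h2, h4, hopt]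
  exact mul_le_mul_of_nonneg_right h1.wins_le (by positivity)
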